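/- **Network.** Consider a dc network: a finite connected graph whose buses are partitioned into sources $\mathcal S\neq\emptyset$ and loads $\mathcal L$, with arbitrarily oriented lines $\alpha\in\mathcal E$ of resistance $R_\alpha>0$, inductance $L_\alpha>0$ and time constant $\tau_\alpha=L_\alpha/R_\alpha$, and load capacitances $C_k>0$, $k\in\mathcal L$. Let $\nabla\in\mathbb R^{\mathcal E\times(\mathcal S\cup\mathcal L)}$ be the (transposed) incidence matrix ($+1$ at the start and $-1$ at the end of a line). All sources are ideal: $v_k=V_0>0$ for $k\in\mathcal S$. With load powers $p=(p_k)_{k\in\mathcal L}$, $p_k\ge 0$, the state $x=(i,v_{\mathcal L})$ with $v_k>0$ evolves by $$L_\alpha \dot i_\alpha=-R_\alpha i_\alpha+\sum_{k}\nabla_{\alpha k}v_k\ (\alpha\in\mathcal E),\qquad C_k\dot v_k=-\frac{p_k}{v_k}-\sum_{\alpha}\nabla_{\alpha k}i_\alpha\ (k\in\mathcal L).$$ Write $p_\Sigma=\sum_{k\in\mathcal L}p_k$. **Design parameters.** Let $R_{\max},P_{\max},V_{\min},V_{\mathrm{tr}}$ and $p_k^{\max}$ ($k\in\mathcal L$)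 satisfy $\sum_\alpha R_\alpha\le R_{\max}$, $P_{\max}<V_0^2/(4R_{\max})$, $V_0/2<V_{\min}<V_0$, $P_{\max}\le V_{\min}(V_0-V_{\min})/R_{\max}$ and $V_0/2\le V_{\mathrm{tr}}\le V_{\min}$. Let $\tau\ge\tau_\alpha$ and $\tau_{\max}>\tau_\alpha$ for all $\alpha$ (for instance $\tau=\tau_{\max}$). Put $$V_{\mathrm{high}}(p_\Sigma)=\frac{V_0}{2}\Bigl(1+\sqrt{1-4R_{\max}p_\Sigma/V_0^2}\Bigr),\qquad V_{\mathrm{high}}^-=V_{\mathrm{high}}(p_\Sigma^-),$$ $$\mathcal G_{\mathrm{tr}}^+=\frac{(V_{\mathrm{tr}}-V_0)^2}{2R_{\max}}+p_\Sigma^+\log V_{\mathrm{tr}},\qquad \mathcal G_{\mathrm{ini}}^+=\frac{p_\Sigma^-}{2}\,\frac{V_0-V_{\mathrm{high}}^-}{V_{\mathrm{high}}^-}+p_\Sigma^+\log V_0 .$$ For load powers $p$ with $p_\Sigma\le P_{\max}$, a *high-voltage equilibrium* is an equilibrium with $v_k\ge V_{\mathrm{high}}(p_\Sigma)$ for all $k\in\mathcal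 L$. **Theorem.** Suppose that every load $k\in\mathcal L$ satisfies $$C_k>\frac{\tau\,p_k^{\max}}{V_{\mathrm{tr}}^2}\qquad\text{and}\qquad C_k>\max_{p_\Sigma^-,\,p_\Sigma^+}\ \frac{\tau_{\max}}{2(\mathcal G_{\mathrm{tr}}^+-\mathcal G_{\mathrm{ini}}^+)}\Bigl(\frac{p_\Sigma^--p_\Sigma^+}{V_{\mathrm{high}}^-}\Bigr)^2,$$ where the maximum is over all real numbers $0\le p_\Sigma^-,p_\Sigma^+\le P_{\max}$ with $|p_\Sigma^+-p_\Sigma^-|\le p_k^{\max}$, and where it is assumed that $\mathcal G_{\mathrm{ini}}^+<\mathcal G_{\mathrm{tr}}^+$ for all these pairs. Let $p^-,p^+$ be load powers with $0\le p_k^\pm\le p_k^{\max}$ and $p_\Sigma^\pm\le P_{\max}$ that differ at most at a single load $\kappa$, and let $x^-$ be a high-voltage equilibrium for $p^-$. Then there is exactly one high-voltage equilibrium $x^{\mathrm{sep}}$ for $p^+$; it is asymptotically stable for the dynamics with powers $p^+$; and the dynamics with powers $p^+$ have a solution on $[0,\infty)$ with $x(0)=x^-$, and every such solution satisfies $x(t)\to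 x^{\mathrm{sep}}$ as $t\to\infty$. -/

import Mathlib

open Filter Topology

noncomputable section

/-- A dc network: `S` is the set of source buses, `K` the set of load buses, `E` the set of lines.
Every line has an (arbitrary) orientation, a resistance and an inductance; every load bus has a
capacitor in parallel with its constant-power load; all sources are ideal, at voltage `V₀`. -/
structure DCNetwork (S K E : Type*) where
  src : E → S ⊕ K
  tgt : E → S ⊕ K
  /-- line resistances -/
  res : E → ℝ
  /-- line inductances -/
  ind : E → ℝ
  /-- load capacitances -/
  cap : K → ℝ
  /-- source voltage -/
  V₀ : ℝ
  res_pos : ∀ α, 0 < res α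
  ind_pos : ∀ α, 0 < ind α
  cap_pos : ∀ k, 0 < cap k
  V₀_pos : 0 < V₀

namespace DCNetwork

variable {S K E : Type*}

/-- The underlying undirected graph on the buses. -/
def graph (N : DCNetwork S K E) : SimpleGraph (S ⊕ K) :=
  SimpleGraph.fromRel fun a b => ∃ α, N.src α = a ∧ N.tgt α = b

open Classical in
/-- The (transposed) incidence matrix `∇`. -/
def incidence (N : DCNetwork S K E) : Matrix E (S ⊕ K) ℝ :=
  fun α j => (if N.src α = j then 1 else 0) - (if N.tgt α = j then 1 else 0)

/-- The time constant `τ_α = L_α / R_α` of a line. -/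
def timeConst (N : DCNetwork S K E) (α : E) : ℝ := N.ind α / N.res α

/-- The voltages of all buses, given those of the load buses. -/
def busVoltage (N : DCNetwork S K E) (v : K → ℝ) : S ⊕ K → ℝ := Sum.elim (fun _ => N.V₀) v

variable [Fintype S] [Fintype K] [Fintype E]

/-- The right-hand side `(di/dt, dv/dt)` of the dynamics, at the state `x = (i, v)`
(line currents, load voltages), when load `k` draws the power `p k`. -/
def vectorField (N : DCNetwork S K E) (p : K → ℝ) (x : (E → ℝ) × (K → ℝ)) :
    (E → ℝ) × (K → ℝ) :=
  (fun α => (-(N.res α * x.1 α) + ∑ j, N.incidence α j * N.busVoltage x.2 j) / N.ind α,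
   fun k => (-(p k / x.2 k) - ∑ α, N.incidence α (Sum.inr k) * x.1 α) / N.cap k)

/-- `x` is a solution of the dynamics on `[0, ∞)`, with positive load voltages. -/
structure IsTrajectory (N : DCNetwork S K E) (p : K → ℝ) (x : ℝ → (E → ℝ) × (K → ℝ)) :
    Prop where
  voltage_pos : ∀ t, 0 ≤ t → ∀ k, 0 < (x t).2 k
  hasDeriv : ∀ t, 0 ≤ t → HasDerivWithinAt x (N.vectorField p (x t)) (Set.Ici 0) t

/-- Equilibrium states (with positive load voltages). -/
def IsEquilibrium (N : DCNetwork S K E) (p : K → ℝ) (x : (E → ℝ) × (K → ℝ)) : Prop :=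
  (∀ k, 0 < x.2 k) ∧ N.vectorField p x = 0

/-- Asymptotic stability of a state `z`: solutions that start near `z` exist for all times, stay
near `z`, and converge to `z`. -/
def IsAsymptoticallyStable (N : DCNetwork S K E) (p : K → ℝ) (z : (E → ℝ) × (K → ℝ)) : Prop :=
  (∀ ε > 0, ∃ δ > 0, ∀ x₀, dist x₀ z < δ →
    (∃ x, N.IsTrajectory p x ∧ x 0 = x₀) ∧
    ∀ x, N.IsTrajectory p x → x 0 = x₀ → ∀ t, 0 ≤ t → dist (x t) z < ε) ∧
  ∃ δ > 0, ∀ x, N.IsTrajectory p x → dist (x 0) z < δ → Tendsto x atTop (𝓝 z)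

/-- The high-voltage solution of the two-bus system with source voltage `V₀`, line resistance `R`
and load `p`, where `V₀² / (4R)` is the largest load that can be supported. -/
def Vhigh (V₀ R p : ℝ) : ℝ := V₀ / 2 * (1 + √(1 - p / (V₀ ^ 2 / (4 * R))))

/-- `x` is a high-voltage equilibrium `x^sep` for the loads `p`: an equilibrium all of whose load
voltages are at least `V_high(p_Σ, R_max)`. -/
def IsHighVoltageEquilibrium (N : DCNetwork S K E) (Rmax : ℝ) (p : K → ℝ)
    (x : (E → ℝ) × (K → ℝ)) : Prop :=
  N.IsEquilibrium p x ∧ ∀ k, Vhigh N.V₀ Rmax (∑ j, p j) ≤ x.2 k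

/-- `𝒢_tr⁺`, as a function of the total post-switch load. -/
def Gtr (V₀ Rmax Vtr pPlus : ℝ) : ℝ := (Vtr - V₀) ^ 2 / (2 * Rmax) + pPlus * Real.log Vtr

/-- `𝒢_ini⁺`, as a function of the total pre- and post-switch loads. -/
def Gini (V₀ Rmax pMinus pPlus : ℝ) : ℝ :=
  pMinus / 2 * ((V₀ - Vhigh V₀ Rmax pMinus) / Vhigh V₀ Rmax pMinus) + pPlus * Real.log V₀

/-- The admissible pairs `(p_Σ⁻, p_Σ⁺)` of total loads before and after the switching of a load
whose power is at most `pmax`. -/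
def admissibleLoads (Pmax pmax : ℝ) : Set (ℝ × ℝ) :=
  {q | 0 ≤ q.1 ∧ q.1 ≤ Pmax ∧ 0 ≤ q.2 ∧ q.2 ≤ Pmax ∧ |q.2 - q.1| ≤ pmax}

/-- The capacitance required for the switching event with total loads `q = (p_Σ⁻, p_Σ⁺)`. -/
def switchCapacitance (V₀ Rmax Vtr tauMax : ℝ) (q : ℝ × ℝ) : ℝ :=
  tauMax / (2 * (Gtr V₀ Rmax Vtr q.2 - Gini V₀ Rmax q.1 q.2)) *
    ((q.1 - q.2) / Vhigh V₀ Rmax q.1) ^ 2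

/-- The worst case of `switchCapacitance` over all admissible pairs of total loads. (The set of
admissible pairs is compact, so this is a maximum as soon as `Gini < Gtr` on it.) -/
def capacitanceBound (V₀ Rmax Vtr tauMax Pmax pmax : ℝ) : ℝ :=
  sSup (switchCapacitance V₀ Rmax Vtr tauMax '' admissibleLoads Pmax pmax)

end DCNetwork

end

/-! The proof is a Lyapunov argument with the Brayton–Moser function `storage`: half the power
dissipated at the given voltages, plus `∑ p_k log v_k`, plus squares of the velocities `dv/dt` and
`di/dt` weighted by a free time constant `l`. Along solutions it decreases at the rate `∑ (C_k - l
p_k / v_k²) (dv_k/dt)² + ∑ (l - τ_α) R_α (di_α/dt)²` (`hasDerivWithinAt_storage`). This is positive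
definite in the velocity on `{v ≥ Vtr}` once `τ_α < l` and `l p_k < C_k Vtr²`; the first capacitance
condition leaves room for such an `l ≤ tauMax`.

The face `v_k = Vtr` is an energy barrier. Following a path from a load to a source, Cauchy–Schwarz
bounds the squared voltage difference by `Rmax` times the dissipated power (`sq_sub_le`), so
`storage` is at least `Gtr` where all voltages are at least `Vtr` and one equals it. Switching
changes only the velocity of `v_κ`, so just afterwards `storage` exceeds `Gini` by at most a
multiple of `1 / C_κ` (`storage_le_of_switch`), and the second capacitance condition keeps it below
`Gtr`. A sublevel set at an intermediate level is therefore compact and cannot be left.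

Since `p_Σ < V₀² / (4 Rmax)`, at most one equilibrium has all voltages above `V₀ / 2`
(`eq_of_half_le`). The minimizer of `storage` on the sublevel set is an equilibrium, hence the only
one there, and strict decrease away from it gives existence, stability and attraction. -/

/-! ### Strict Lyapunov functions on compact sets. -/

section Lyapunov

variable {X : Type*} [NormedAddCommGroup X] [NormedSpace ℝ X]

/-- A bounded, globally Lipschitz vector field has a solution on `[0, ∞)` through every point. -/
theorem exists_solution_Ici_of_lipschitzWith_of_bounded [CompleteSpace X] {F : X → X}
    {k M : NNReal} (hF : LipschitzWith k F) (hM : ∀ x, ‖F x‖ ≤ M) (x₀ : X) :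
    ∃ x : ℝ → X, x 0 = x₀ ∧ ∀ t, 0 ≤ t → HasDerivWithinAt x (F (x t)) (Set.Ici 0) t := by
  have hloc : ∀ n : ℕ, ∃ x : ℝ → X, x 0 = x₀ ∧
      ∀ t ∈ Set.Icc (0 : ℝ) n, HasDerivWithinAt x (F (x t)) (Set.Icc 0 n) t := by
    intro n
    -- A field bounded by `M` moves a point by at most `M * n` in time `n`, so this radius makes
    -- Picard–Lindelöf apply on all of `[0, n]`.
    have hpl : IsPicardLindelof (fun _ => F) (⟨0, le_rfl, n.cast_nonneg⟩ : Set.Icc (0 : ℝ) n)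
        x₀ (M * n) 0 M k :=
      { lipschitzOnWith := fun _ _ => hF.lipschitzOnWith
        continuousOn := fun _ _ => continuousOn_const
        norm_le := fun _ _ x _ => hM x
        mul_max_le := by simp }
    exact hpl.exists_eq_forall_mem_Icc_hasDerivWithinAt₀
  choose y hy0 hy using hloc
  have hright : ∀ n : ℕ, ∀ t ∈ Set.Ico (0 : ℝ) n,
      HasDerivWithinAt (y n) (F (y n t)) (Set.Ici t) t := fun n t ht =>
    ((hy n t ⟨ht.1, ht.2.le⟩).mono (Set.Icc_subset_Icc_left ht.1)).mono_of_mem_nhdsWithin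
      (Icc_mem_nhdsGE ht.2)
  have heq : ∀ m n : ℕ, m ≤ n → Set.EqOn (y m) (y n) (Set.Icc 0 m) := by
    intro m n hmn
    have hmn' : (m : ℝ) ≤ n := by exact_mod_cast hmn
    refine ODE_solution_unique (v := fun _ => F) (fun _ => hF)
      (fun t ht => (hy m t ht).continuousWithinAt) (hright m)
      (fun t ht => ((hy n t ⟨ht.1, ht.2.trans hmn'⟩).continuousWithinAt.mono
        (Set.Icc_subset_Icc_right hmn')))
      (fun t ht => hright n t ⟨ht.1, ht.2.trans_le hmn'⟩) ?_
    rw [hy0, hy0]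
  have heq' : ∀ n : ℕ, ∀ t : ℝ, 0 ≤ t → t < n → y (⌊t⌋₊ + 1) t = y n t := by
    intro n t ht htn
    have h1 : ⌊t⌋₊ + 1 ≤ n := (Nat.floor_lt ht).2 htn
    exact heq _ n h1 ⟨ht, by push_cast; exact (Nat.lt_floor_add_one t).le⟩
  -- `⌊t⌋₊ + 1` is the least integer beyond `t`; by uniqueness every longer solution agrees with
  -- this one at `t`.
  refine ⟨fun t => y (⌊t⌋₊ + 1) t, by simpa using hy0 1, fun t ht => ?_⟩
  obtain ⟨n, hn⟩ := exists_nat_gt t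
  have hmem : Set.Iio (n : ℝ) ∈ 𝓝[Set.Ici 0] t := mem_nhdsWithin_of_mem_nhds (Iio_mem_nhds hn)
  have h := hy n t ⟨ht, hn.le⟩
  have h' : HasDerivWithinAt (y n) (F (y n t)) (Set.Ici 0) t :=
    h.mono_of_mem_nhdsWithin (by
      filter_upwards [hmem, self_mem_nhdsWithin] with u hu hu0
      exact ⟨hu0, le_of_lt hu⟩)
  have hval := heq' n t ht hn
  simp only [hval]
  refine h'.congr_of_eventuallyEq ?_ hval
  filter_upwards [hmem, self_mem_nhdsWithin] with u hu hu0
  exact heq' n u hu0 hu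

/-- `Y` is a strict Lyapunov function for the vector field `F` on the compact set `B`, with
dissipation rate `f`, and its sublevel set `{Y ≤ c}` in `B` avoids the boundary of `B` and
contains at most one equilibrium. -/
structure IsStrictLyapunov (F : X → X) (Y f : X → ℝ) (B : Set X) (c : ℝ) : Prop where
  compact : IsCompact B
  continuousOn : ContinuousOn Y B
  continuousOn_rate : ContinuousOn f B
  hasDeriv : ∀ (x : ℝ → X) (s : Set ℝ) (t : ℝ), x t ∈ B → HasDerivWithinAt x (F (x t)) s t →
    HasDerivWithinAt (fun u => Y (x u)) (-f (x t)) s t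
  rate_nonneg : ∀ x ∈ B, 0 ≤ f x
  eq_zero_of_rate : ∀ x ∈ B, f x = 0 → F x = 0
  mem_nhds : ∀ x ∈ B, Y x ≤ c → B ∈ 𝓝 x
  unique : ∀ x ∈ B, Y x ≤ c → F x = 0 → ∀ y ∈ B, Y y ≤ c → F y = 0 → x = y

namespace IsStrictLyapunov

variable {F : X → X} {Y f : X → ℝ} {B : Set X} {c : ℝ}

/-- Mean value inequality. It is used with `m = 0` for monotonicity and with `m > 0` to exclude that
the rate stays away from zero forever. -/
theorem sub_le_of_forall_mem (h : IsStrictLyapunov F Y f B c) {x : ℝ → X} {m a b : ℝ}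
    (ha : 0 ≤ a) (hab : a ≤ b)
    (hx : ∀ t ∈ Set.Icc a b, HasDerivWithinAt x (F (x t)) (Set.Ici 0) t)
    (hB : ∀ t ∈ Set.Icc a b, x t ∈ B) (hm : ∀ t ∈ Set.Icc a b, m ≤ f (x t)) :
    Y (x b) - Y (x a) ≤ -m * (b - a) := by
  have hd : ∀ t ∈ Set.Icc a b,
      HasDerivWithinAt (fun u => Y (x u)) (-f (x t)) (Set.Ici 0) t := fun t ht =>
    h.hasDeriv x _ t (hB t ht) (hx t ht)
  have hd' : ∀ t ∈ interior (Set.Icc a b), HasDerivAt (fun u => Y (x u)) (-f (x t)) t := by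
    intro t ht
    rw [interior_Icc] at ht
    exact (hd t ⟨ht.1.le, ht.2.le⟩).hasDerivAt (Ici_mem_nhds (ha.trans_lt ht.1))
  refine (convex_Icc a b).image_sub_le_mul_sub_of_deriv_le (f := fun u => Y (x u))
    (fun t ht => ((hd t ht).continuousWithinAt.mono fun u hu => ha.trans hu.1))
    (fun t ht => (hd' t ht).differentiableAt.differentiableWithinAt)
    (fun t ht => ?_) a ⟨le_rfl, hab⟩ b ⟨hab, le_rfl⟩ hab
  rw [(hd' t ht).deriv]
  exact neg_le_neg (hm t (interior_subset ht))

/-- The sublevel set `{Y ≤ c}` in `B` is positively invariant, for every curve that follows the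
vector field as long as it is in `B`. -/
theorem forall_mem (h : IsStrictLyapunov F Y f B c) {x : ℝ → X} (hc : ContinuousOn x (Set.Ici 0))
    (hx : ∀ t, 0 ≤ t → x t ∈ B → HasDerivWithinAt x (F (x t)) (Set.Ici 0) t)
    (h0 : x 0 ∈ B) (h0c : Y (x 0) ≤ c) {t : ℝ} (ht : 0 ≤ t) : x t ∈ B := by
  have hmain : ∀ T, 0 ≤ T → (∀ u ∈ Set.Icc 0 T, x u ∈ B) → Y (x T) ≤ c := by
    intro T hT hu
    have := h.sub_le_of_forall_mem (m := 0) le_rfl hT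
      (fun t ht => hx t ht.1 (hu t ht)) hu (fun t ht => h.rate_nonneg _ (hu t ht))
    linarith
  have hclosed : IsClosed (x ⁻¹' B ∩ Set.Icc 0 t) := by
    rw [Set.inter_comm]
    exact (hc.mono fun u hu => hu.1).preimage_isClosed_of_isClosed isClosed_Icc
      h.compact.isClosed
  -- Continuous induction: while the curve has stayed in `B`, `Y` has not increased, so the curve is
  -- at an interior point of `B` and stays in `B` a little longer.
  refine (hclosed.Icc_subset_of_forall_mem_nhdsGT_of_Icc_subset h0 fun u hu hsub => ?_)
    ⟨ht, le_rfl⟩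
  have hY := hmain u hu.1 fun s hs => hsub hs
  have hB := h.mem_nhds (x u) (hsub ⟨hu.1, le_rfl⟩) hY
  exact ((hc u hu.1).mono fun s hs => le_trans hu.1 (le_of_lt hs)) hB

theorem antitoneOn (h : IsStrictLyapunov F Y f B c) {x : ℝ → X}
    (hx : ∀ t, 0 ≤ t → HasDerivWithinAt x (F (x t)) (Set.Ici 0) t)
    (h0 : x 0 ∈ B) (h0c : Y (x 0) ≤ c) : AntitoneOn (fun t => Y (x t)) (Set.Ici 0) := by
  have hB : ∀ t, 0 ≤ t → x t ∈ B := fun t ht =>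
    h.forall_mem (fun u hu => (hx u hu).continuousWithinAt) (fun u hu _ => hx u hu) h0 h0c ht
  intro a ha b hb hab
  have := h.sub_le_of_forall_mem (m := 0) ha hab
    (fun t ht => hx t (le_trans ha ht.1)) (fun t ht => hB t (le_trans ha ht.1))
    (fun t ht => h.rate_nonneg _ (hB t (le_trans ha ht.1)))
  simp only
  linarith

theorem isCompact_sublevel (h : IsStrictLyapunov F Y f B c) : IsCompact {x ∈ B | Y x ≤ c} := by
  have : IsClosed (B ∩ Y ⁻¹' Set.Iic c) :=
    h.continuousOn.preimage_isClosed_of_isClosed h.compact.isClosed isClosed_Iic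
  exact h.compact.of_isClosed_subset this Set.inter_subset_left

/-- A minimum of `Y` on the sublevel set is an equilibrium. -/
theorem eq_zero_of_isMinOn (h : IsStrictLyapunov F Y f B c) {z : X} (hz : z ∈ B) (hzc : Y z ≤ c)
    (hmin : ∀ x ∈ B, Y x ≤ c → Y z ≤ Y x) : F z = 0 := by
  refine h.eq_zero_of_rate z hz ?_
  -- No solution through `z` is needed: the straight line with velocity `F z` is tangent to the
  -- field at `s = 0`, so `Y` has derivative `-f z` along it, which vanishes at a minimum.
  have hd : HasDerivAt (fun s : ℝ => z + s • F z) (F z) 0 := by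
    simpa using ((hasDerivAt_id (0 : ℝ)).smul_const (F z)).const_add z
  have hY : HasDerivAt (fun s : ℝ => Y (z + s • F z)) (-f z) 0 := by
    have := h.hasDeriv (fun s : ℝ => z + s • F z) Set.univ 0 (by simpa using hz)
      (by simpa using hd)
    simpa using this
  have hcont : Tendsto (fun s : ℝ => z + s • F z) (𝓝 0) (𝓝 z) := by
    simpa using hd.continuousAt.tendsto
  have hlocal : IsLocalMin (fun s : ℝ => Y (z + s • F z)) 0 := by
    filter_upwards [hcont (h.mem_nhds z hz hzc)] with s hs
    rcases le_total (Y (z + s • F z)) c with hle | hle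
    · simpa using hmin _ hs hle
    · simpa using hzc.trans hle
  have := hlocal.hasDerivAt_eq_zero hY
  linarith

theorem exists_minimizer (h : IsStrictLyapunov F Y f B c) (hne : ∃ x ∈ B, Y x ≤ c) :
    ∃ z ∈ B, Y z ≤ c ∧ F z = 0 ∧ ∀ x ∈ B, Y x ≤ c → Y z ≤ Y x := by
  obtain ⟨x, hx, hxc⟩ := hne
  obtain ⟨z, hz, hmin⟩ := h.isCompact_sublevel.exists_isMinOn ⟨x, hx, hxc⟩
    (h.continuousOn.mono fun _ hy => hy.1)
  have hmin' : ∀ x ∈ B, Y x ≤ c → Y z ≤ Y x := fun x hx hxc => hmin ⟨hx, hxc⟩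
  exact ⟨z, hz.1, hz.2, h.eq_zero_of_isMinOn hz.1 hz.2 hmin', hmin'⟩

/-- Points of the sublevel set with nearly minimal `Y` are close to the minimizer. -/
theorem exists_forall_lt_dist_lt (h : IsStrictLyapunov F Y f B c) {z : X} (hz : z ∈ B)
    (hzc : Y z ≤ c) (hmin : ∀ x ∈ B, Y x ≤ c → Y z ≤ Y x) {ε : ℝ} (hε : 0 < ε) :
    ∃ η > Y z, ∀ x ∈ B, Y x ≤ c → Y x < η → dist x z < ε := by
  have hcpt : IsCompact ({x ∈ B | Y x ≤ c} \ Metric.ball z ε) :=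
    h.isCompact_sublevel.diff Metric.isOpen_ball
  rcases Set.eq_empty_or_nonempty ({x ∈ B | Y x ≤ c} \ Metric.ball z ε) with he | hne
  · refine ⟨Y z + 1, by linarith, fun x hx hxc _ => ?_⟩
    by_contra hcon
    have : x ∈ ({x ∈ B | Y x ≤ c} \ Metric.ball z ε) := ⟨⟨hx, hxc⟩, hcon⟩
    simp [he] at this
  · obtain ⟨w, hw, hwmin⟩ := hcpt.exists_isMinOn hne (h.continuousOn.mono fun _ hy => hy.1.1)
    refine ⟨Y w, lt_of_le_of_ne (hmin w hw.1.1 hw.1.2) fun heq => ?_, fun x hx hxc hlt => ?_⟩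
    -- If the minimum outside the ball equalled `Y z`, then `w` would be a second minimizer, hence a
    -- second equilibrium.
    · have hw0 : F w = 0 := h.eq_zero_of_isMinOn hw.1.1 hw.1.2 fun x hx hxc =>
        heq ▸ hmin x hx hxc
      have := h.unique w hw.1.1 hw.1.2 hw0 z hz hzc (h.eq_zero_of_isMinOn hz hzc hmin)
      exact hw.2 (this ▸ Metric.mem_ball_self hε)
    · by_contra hcon
      exact absurd (hwmin (⟨⟨hx, hxc⟩, hcon⟩ : x ∈ {x ∈ B | Y x ≤ c} \ Metric.ball z ε))
        (not_le.2 hlt)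

/-- Every solution that starts in the sublevel set converges to the minimizer. -/
theorem tendsto (h : IsStrictLyapunov F Y f B c) {z : X} (hz : z ∈ B)
    (hzc : Y z ≤ c) (hmin : ∀ x ∈ B, Y x ≤ c → Y z ≤ Y x) {x : ℝ → X}
    (hx : ∀ t, 0 ≤ t → HasDerivWithinAt x (F (x t)) (Set.Ici 0) t)
    (h0 : x 0 ∈ B) (h0c : Y (x 0) ≤ c) : Tendsto x atTop (𝓝 z) := by
  have hB : ∀ t, 0 ≤ t → x t ∈ B := fun t ht =>
    h.forall_mem (fun u hu => (hx u hu).continuousWithinAt) (fun u hu _ => hx u hu) h0 h0c ht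
  have hanti := h.antitoneOn hx h0 h0c
  have hc : ∀ t, 0 ≤ t → Y (x t) ≤ c := fun t ht =>
    (hanti (Set.mem_Ici.2 le_rfl) (Set.mem_Ici.2 ht) ht).trans h0c
  rw [Metric.tendsto_atTop]
  intro ε hε
  obtain ⟨η, hη, hηε⟩ := h.exists_forall_lt_dist_lt hz hzc hmin hε
  suffices ∃ T, 0 ≤ T ∧ Y (x T) < η by
    obtain ⟨T, hT, hTη⟩ := this
    refine ⟨T, fun t ht => hηε _ (hB t (hT.trans ht)) (hc t (hT.trans ht)) ?_⟩
    exact (hanti (Set.mem_Ici.2 hT) (Set.mem_Ici.2 (hT.trans ht)) ht).trans_lt hTη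
  -- Otherwise the solution stays in the compact set `{η ≤ Y ≤ c}`, which contains no equilibrium.
  -- There `f` has a positive minimum, so `Y` falls at least linearly, contradicting `η ≤ Y`.
  by_contra! hcon
  have hcpt : IsCompact ({x ∈ B | Y x ≤ c} ∩ {x ∈ B | η ≤ Y x}) := by
    refine h.isCompact_sublevel.inter_right ?_
    exact h.continuousOn.preimage_isClosed_of_isClosed h.compact.isClosed isClosed_Ici
  obtain ⟨w, hw, hwmin⟩ := hcpt.exists_isMinOn (f := f)
    ⟨x 0, ⟨h0, h0c⟩, h0, hcon 0 le_rfl⟩ (h.continuousOn_rate.mono fun _ hy => hy.1.1)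
  have hpos : 0 < f w := by
    refine lt_of_le_of_ne (h.rate_nonneg w hw.1.1) fun heq => ?_
    have := h.unique w hw.1.1 hw.1.2 (h.eq_zero_of_rate w hw.1.1 heq.symm) z hz hzc
      (h.eq_zero_of_isMinOn hz hzc hmin)
    rw [this] at hw
    exact absurd hw.2.2 (not_le.2 hη)
  have hbound : ∀ T, 0 ≤ T → Y (x T) - Y (x 0) ≤ -f w * (T - 0) := fun T hT =>
    h.sub_le_of_forall_mem le_rfl hT (fun t ht => hx t ht.1) (fun t ht => hB t ht.1)
      (fun t ht => hwmin (⟨⟨hB t ht.1, hc t ht.1⟩, hB t ht.1, hcon t ht.1⟩ :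
        x t ∈ {x ∈ B | Y x ≤ c} ∩ {x ∈ B | η ≤ Y x}))
  have hT0 : 0 ≤ (Y (x 0) - η + 1) / f w := by
    have := hcon 0 le_rfl
    positivity [sub_nonneg.2 this]
  have h1 := hbound _ hT0
  have h2 := hcon _ hT0
  have h3 : f w * ((Y (x 0) - η + 1) / f w) = Y (x 0) - η + 1 := by field_simp
  linarith

/-- If the vector field is Lipschitz on `B` and `B` is a Lipschitz retract, then solutions that
start in the sublevel set exist on `[0, ∞)`. -/
theorem exists_solution [CompleteSpace X] (h : IsStrictLyapunov F Y f B c) {k l : NNReal}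
    (hF : LipschitzOnWith k F B) {π : X → X} (hπ : LipschitzWith l π) (hπB : ∀ x, π x ∈ B)
    (hπid : ∀ x ∈ B, π x = x) {x₀ : X} (h0 : x₀ ∈ B) (h0c : Y x₀ ≤ c) :
    ∃ x : ℝ → X, x 0 = x₀ ∧ (∀ t, 0 ≤ t → x t ∈ B) ∧
      ∀ t, 0 ≤ t → HasDerivWithinAt x (F (x t)) (Set.Ici 0) t := by
  -- The field `F ∘ π` is globally Lipschitz and bounded and agrees with `F` on `B`. Invariance
  -- requires the curve to follow `F` only while in `B`, so it applies to solutions of the modified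
  -- field.
  have hlip : LipschitzWith (k * l) (F ∘ π) := by
    rw [← lipschitzOnWith_univ]
    exact hF.comp hπ.lipschitzOnWith fun x _ => hπB x
  obtain ⟨M, hM⟩ := h.compact.exists_bound_of_continuousOn hF.continuousOn
  obtain ⟨x, hx0, hx⟩ := exists_solution_Ici_of_lipschitzWith_of_bounded (M := M.toNNReal) hlip
    (fun y => (hM _ (hπB y)).trans (Real.le_coe_toNNReal M)) x₀
  have hx' : ∀ t, 0 ≤ t → x t ∈ B → HasDerivWithinAt x (F (x t)) (Set.Ici 0) t := by
    intro t ht htB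
    simpa [hπid _ htB] using hx t ht
  have hB : ∀ t, 0 ≤ t → x t ∈ B := fun t ht =>
    h.forall_mem (fun u hu => (hx u hu).continuousWithinAt) hx' (hx0 ▸ h0) (hx0 ▸ h0c) ht
  exact ⟨x, hx0, hB, fun t ht => hx' t ht (hB t ht)⟩

/-- Lyapunov stability of the minimizer. -/
theorem exists_forall_dist_lt (h : IsStrictLyapunov F Y f B c) {z : X} (hz : z ∈ B)
    (hzc : Y z < c) (hmin : ∀ x ∈ B, Y x ≤ c → Y z ≤ Y x) {ε : ℝ} (hε : 0 < ε) :
    ∃ δ > 0, ∀ x₀, dist x₀ z < δ → x₀ ∈ B ∧ Y x₀ ≤ c ∧ ∀ x : ℝ → X, x 0 = x₀ →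
      (∀ t, 0 ≤ t → HasDerivWithinAt x (F (x t)) (Set.Ici 0) t) →
        ∀ t, 0 ≤ t → dist (x t) z < ε := by
  obtain ⟨η, hη, hηε⟩ := h.exists_forall_lt_dist_lt hz hzc.le hmin hε
  have hB := h.mem_nhds z hz hzc.le
  have hlt : ∀ᶠ x in 𝓝 z, Y x < min η c :=
    (h.continuousOn.continuousAt hB).eventually_lt continuousAt_const (lt_min hη hzc)
  obtain ⟨δ, hδ, hsub⟩ := Metric.eventually_nhds_iff.1 (hlt.and hB)
  refine ⟨δ, hδ, fun x₀ hx₀ => ?_⟩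
  obtain ⟨h1, h2⟩ := hsub hx₀
  have h2' : x₀ ∈ B := h2
  have hle : Y x₀ ≤ c := (h1.trans_le (min_le_right _ _)).le
  refine ⟨h2, hle, fun x hx0 hx t ht => ?_⟩
  subst hx0
  have hBt := h.forall_mem (fun u hu => (hx u hu).continuousWithinAt) (fun u hu _ => hx u hu)
    h2' hle ht
  have hYt : Y (x t) ≤ Y (x 0) :=
    h.antitoneOn hx h2' hle (Set.mem_Ici.2 le_rfl) (Set.mem_Ici.2 ht) ht
  exact hηε _ hBt (hYt.trans hle) (hYt.trans_lt (h1.trans_le (min_le_left _ _)))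

end IsStrictLyapunov

end Lyapunov

/-! ### Potentials, dissipation and the energy balance on the network. -/

noncomputable section

namespace DCNetwork

variable {S K E : Type*}

/-- The difference of a bus potential `φ` along the line `α`. -/
def drop (N : DCNetwork S K E) (φ : S ⊕ K → ℝ) (α : E) : ℝ := φ (N.src α) - φ (N.tgt α)

/-- Extension of a function on the loads by zero on the sources. -/
def extendZero (d : K → ℝ) : S ⊕ K → ℝ := Sum.elim (fun _ => 0) d

theorem drop_busVoltage_sub (N : DCNetwork S K E) (v w : K → ℝ) (α : E) :
    N.drop (N.busVoltage v) α - N.drop (N.busVoltage w) α =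
      N.drop (extendZero fun k => v k - w k) α := by
  unfold drop busVoltage extendZero
  rcases N.src α with s | k <;> rcases N.tgt α with s' | k' <;> (simp; try ring)

theorem drop_busVoltage (N : DCNetwork S K E) (v : K → ℝ) (α : E) :
    N.drop (N.busVoltage v) α = N.drop (extendZero fun k => v k - N.V₀) α := by
  unfold drop busVoltage extendZero
  rcases N.src α with s | k <;> rcases N.tgt α with s' | k' <;> simp

section Path

variable [Fintype E]

-- Telescoping along the walk. A trail uses each edge once, so the line realizing the first edge is
-- not already counted in the sum for the rest.
open Classical in
theorem abs_sub_le_sum_of_isTrail (N : DCNetwork S K E) (φ : S ⊕ K → ℝ) {a b : S ⊕ K}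
    (w : N.graph.Walk a b) (hw : w.IsTrail) :
    |φ a - φ b| ≤ ∑ α with s(N.src α, N.tgt α) ∈ w.edges, |N.drop φ α| := by
  induction w with
  | nil => simp
  | @cons a c b hadj w ih =>
    rw [SimpleGraph.Walk.isTrail_cons] at hw
    have hedge : ∃ α, s(N.src α, N.tgt α) = s(a, c) ∧ |N.drop φ α| = |φ a - φ c| := by
      rw [graph, SimpleGraph.fromRel_adj] at hadj
      rcases hadj.2 with ⟨α, rfl, rfl⟩ | ⟨α, rfl, rfl⟩
      · exact ⟨α, rfl, rfl⟩
      · exact ⟨α, Sym2.eq_swap, abs_sub_comm _ _⟩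
    obtain ⟨α, hα, hdrop⟩ := hedge
    have hnot : α ∉ Finset.univ.filter fun β => s(N.src β, N.tgt β) ∈ w.edges := by
      simp [hα, hw.2]
    calc |φ a - φ b| ≤ |φ a - φ c| + |φ c - φ b| := abs_sub_le _ _ _
      _ ≤ |N.drop φ α| + ∑ β with s(N.src β, N.tgt β) ∈ w.edges, |N.drop φ β| := by
          rw [hdrop]; gcongr; exact ih hw.1
      _ = ∑ β ∈ insert α (Finset.univ.filter fun β => s(N.src β, N.tgt β) ∈ w.edges),
            |N.drop φ β| := by rw [Finset.sum_insert hnot]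
      _ ≤ _ := by
          refine Finset.sum_le_sum_of_subset_of_nonneg (fun β hβ => ?_) fun _ _ _ => abs_nonneg _
          rw [Finset.mem_insert] at hβ
          rcases hβ with rfl | hβ
          · refine Finset.mem_filter.2 ⟨Finset.mem_univ _, ?_⟩
            rw [hα]
            simp
          · simp only [Finset.mem_filter, Finset.mem_univ, true_and] at hβ
            simp [hβ]

/-- In a connected network, the squared potential difference of two buses is bounded by the total
resistance times the dissipated power. -/
theorem sq_sub_le (N : DCNetwork S K E) (hconn : N.graph.Connected) (φ : S ⊕ K → ℝ)
    (a b : S ⊕ K) :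
    (φ a - φ b) ^ 2 ≤ (∑ α, N.res α) * ∑ α, N.drop φ α ^ 2 / N.res α := by
  classical
  obtain ⟨w⟩ := hconn.preconnected a b
  have h1 := N.abs_sub_le_sum_of_isTrail φ (w.toPath : N.graph.Walk a b) w.toPath.2.isTrail
  have h2 : |φ a - φ b| ≤ ∑ α, |N.drop φ α| := h1.trans
    (Finset.sum_le_sum_of_subset_of_nonneg (Finset.filter_subset _ _) fun _ _ _ => abs_nonneg _)
  calc (φ a - φ b) ^ 2 = |φ a - φ b| ^ 2 := (sq_abs _).symm
    _ ≤ (∑ α, |N.drop φ α|) ^ 2 := by gcongr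
    _ ≤ _ := by
      refine Finset.sum_sq_le_sum_mul_sum_of_sq_le_mul _ (fun α _ => (N.res_pos α).le)
        (fun α _ => div_nonneg (sq_nonneg _) (N.res_pos α).le) fun α _ => ?_
      have := (N.res_pos α).ne'
      rw [sq_abs]
      field_simp
      exact le_rfl

theorem sum_drop_sq_nonneg (N : DCNetwork S K E) (φ : S ⊕ K → ℝ) :
    0 ≤ ∑ α, N.drop φ α ^ 2 / N.res α :=
  Finset.sum_nonneg fun α _ => div_nonneg (sq_nonneg _) (N.res_pos α).le

theorem sum_drop_sq_half (N : DCNetwork S K E) (φ : S ⊕ K → ℝ) :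
    ∑ α, N.drop φ α ^ 2 / (2 * N.res α) = (∑ α, N.drop φ α ^ 2 / N.res α) / 2 := by
  rw [Finset.sum_div]
  exact Finset.sum_congr rfl fun α _ => by rw [div_div, mul_comm]

theorem sq_extendZero_le (N : DCNetwork S K E) [Nonempty S] (hconn : N.graph.Connected)
    {Rmax : ℝ} (hRmax : ∑ α, N.res α ≤ Rmax) (d : K → ℝ) (k : K) :
    d k ^ 2 ≤ Rmax * ∑ α, N.drop (extendZero d) α ^ 2 / N.res α := by
  have h := N.sq_sub_le hconn (extendZero d) (Sum.inr k) (Sum.inl (Classical.arbitrary S))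
  have h' : d k ^ 2 ≤ (∑ α, N.res α) * ∑ α, N.drop (extendZero d) α ^ 2 / N.res α := by
    simpa [extendZero] using h
  exact h'.trans (mul_le_mul_of_nonneg_right hRmax (N.sum_drop_sq_nonneg _))

theorem sq_voltage_sub_le (N : DCNetwork S K E) [Nonempty S] (hconn : N.graph.Connected)
    {Rmax : ℝ} (hRmax : ∑ α, N.res α ≤ Rmax) (v : K → ℝ) (k : K) :
    (v k - N.V₀) ^ 2 ≤ Rmax * ∑ α, N.drop (N.busVoltage v) α ^ 2 / N.res α := by
  simp_rw [drop_busVoltage]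
  exact N.sq_extendZero_le hconn hRmax (fun k => v k - N.V₀) k

/-- This makes `Rmax` and the time constant positive. Without lines, the dissipation bound would
force a potential equal to `0` on sources and `1` on loads to be constant. -/
theorem nonempty_lines (N : DCNetwork S K E) [Nonempty S] [Nonempty K]
    (hconn : N.graph.Connected) : Nonempty E := by
  obtain ⟨s⟩ := ‹Nonempty S›
  obtain ⟨k⟩ := ‹Nonempty K›
  by_contra hE
  rw [not_nonempty_iff] at hE
  have h := N.sq_sub_le hconn (Sum.elim (fun _ => 0) fun _ => 1) (Sum.inr k) (Sum.inl s)
  norm_num at h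

end Path

variable [Fintype S] [Fintype K]

theorem sum_incidence_mul (N : DCNetwork S K E) (φ : S ⊕ K → ℝ) (α : E) :
    ∑ j, N.incidence α j * φ j = N.drop φ α := by
  classical
  simp only [incidence, sub_mul, Finset.sum_sub_distrib, ite_mul, one_mul, zero_mul, drop]
  rw [Finset.sum_ite_eq, Finset.sum_ite_eq]
  simp

theorem sum_incidence_inr_mul (N : DCNetwork S K E) (d : K → ℝ) (α : E) :
    ∑ k, N.incidence α (Sum.inr k) * d k = N.drop (extendZero d) α := by
  rw [← sum_incidence_mul, Fintype.sum_sum_type]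
  simp [extendZero]

variable [Fintype E]

/-- Summation by parts on the network. -/
theorem sum_mul_drop_extendZero (N : DCNetwork S K E) (a : E → ℝ) (d : K → ℝ) :
    ∑ α, a α * N.drop (extendZero d) α =
      ∑ k, d k * ∑ α, N.incidence α (Sum.inr k) * a α := by
  simp_rw [← sum_incidence_inr_mul, Finset.mul_sum]
  rw [Finset.sum_comm]
  exact Finset.sum_congr rfl fun k _ => Finset.sum_congr rfl fun α _ => by ring

theorem vectorField_fst (N : DCNetwork S K E) (p : K → ℝ) (x : (E → ℝ) × (K → ℝ)) (α : E) :
    (N.vectorField p x).1 α =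
      (-(N.res α * x.1 α) + N.drop (N.busVoltage x.2) α) / N.ind α := by
  simp only [vectorField, sum_incidence_mul]

theorem ind_mul_vectorField_fst (N : DCNetwork S K E) (p : K → ℝ) (x : (E → ℝ) × (K → ℝ))
    (α : E) : N.ind α * (N.vectorField p x).1 α =
      -(N.res α * x.1 α) + N.drop (N.busVoltage x.2) α := by
  rw [vectorField_fst, mul_div_cancel₀ _ (N.ind_pos α).ne']

theorem cap_mul_vectorField_snd (N : DCNetwork S K E) (p : K → ℝ) (x : (E → ℝ) × (K → ℝ))
    (k : K) : N.cap k * (N.vectorField p x).2 k =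
      -(p k / x.2 k) - ∑ α, N.incidence α (Sum.inr k) * x.1 α := by
  simp only [vectorField]
  rw [mul_div_cancel₀ _ (N.cap_pos k).ne']

/-! ### The Lyapunov function -/

/-- The Brayton–Moser type Lyapunov function with time constant `l`. -/
def storage (N : DCNetwork S K E) (p : K → ℝ) (l : ℝ) (x : (E → ℝ) × (K → ℝ)) : ℝ :=
  ∑ α, N.drop (N.busVoltage x.2) α ^ 2 / (2 * N.res α) + ∑ k, p k * Real.log (x.2 k) +
    ∑ k, l * N.cap k / 2 * (N.vectorField p x).2 k ^ 2 +
    ∑ α, (l - N.timeConst α) * N.ind α / 2 * (N.vectorField p x).1 α ^ 2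

/-- The rate at which `storage` decreases along the dynamics. -/
def storageRate (N : DCNetwork S K E) (p : K → ℝ) (l : ℝ) (x : (E → ℝ) × (K → ℝ)) : ℝ :=
  ∑ k, (N.cap k - l * p k / x.2 k ^ 2) * (N.vectorField p x).2 k ^ 2 +
    ∑ α, (l - N.timeConst α) * N.res α * (N.vectorField p x).1 α ^ 2

/-- With `U` the line voltages, substitute `U = L di/dt + R i` in the line terms and `p / v = -C
dv/dt - ∇ᵀ i` in the load terms. Besides the rate, this leaves `∑ i dU/dt + l ∑ (di/dt) (dU/dt)`
from the lines, which the loads cancel by summation by parts. -/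
theorem hasDerivWithinAt_storage (N : DCNetwork S K E) (p : K → ℝ) (l : ℝ)
    (x : ℝ → (E → ℝ) × (K → ℝ)) (s : Set ℝ) (t : ℝ) (hpos : ∀ k, 0 < (x t).2 k)
    (hx : HasDerivWithinAt x (N.vectorField p (x t)) s t) :
    HasDerivWithinAt (fun u => N.storage p l (x u)) (-N.storageRate p l (x t)) s t := by
  set F := N.vectorField p (x t) with hF
  have hi : ∀ α, HasDerivWithinAt (fun u => (x u).1 α) (F.1 α) s t := fun α =>
    (((ContinuousLinearMap.proj (R := ℝ) (φ := fun _ : E => ℝ) α).comp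
      (ContinuousLinearMap.fst ℝ (E → ℝ) (K → ℝ))).hasFDerivAt).comp_hasDerivWithinAt t hx
  have hv : ∀ k, HasDerivWithinAt (fun u => (x u).2 k) (F.2 k) s t := fun k =>
    (((ContinuousLinearMap.proj (R := ℝ) (φ := fun _ : K => ℝ) k).comp
      (ContinuousLinearMap.snd ℝ (E → ℝ) (K → ℝ))).hasFDerivAt).comp_hasDerivWithinAt t hx
  have hbus : ∀ j, HasDerivWithinAt (fun u => N.busVoltage (x u).2 j) (extendZero F.2 j) s t := by
    rintro (j | k)
    · simpa [busVoltage, extendZero] using hasDerivWithinAt_const t s N.V₀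
    · simpa [busVoltage, extendZero] using hv k
  have hU : ∀ α, HasDerivWithinAt (fun u => N.drop (N.busVoltage (x u).2) α)
      (N.drop (extendZero F.2) α) s t := fun α => (hbus _).sub (hbus _)
  have hF1 : ∀ α, HasDerivWithinAt (fun u => (N.vectorField p (x u)).1 α)
      ((-(N.res α * F.1 α) + N.drop (extendZero F.2) α) / N.ind α) s t := by
    intro α
    simp only [vectorField_fst]
    exact ((((hi α).const_mul _).neg).add (hU α)).div_const _
  have hF2 : ∀ k, HasDerivWithinAt (fun u => (N.vectorField p (x u)).2 k)
      ((p k * F.2 k / (x t).2 k ^ 2 - ∑ α, N.incidence α (Sum.inr k) * F.1 α) / N.cap k) s t := by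
    intro k
    have h1 : HasDerivWithinAt (fun u => -(p k / (x u).2 k))
        (p k * F.2 k / (x t).2 k ^ 2) s t := by
      convert! ((hasDerivWithinAt_const t s (p k)).div (hv k) (hpos k).ne').neg using 1
      ring
    have h2 : HasDerivWithinAt (fun u => ∑ α, N.incidence α (Sum.inr k) * (x u).1 α)
        (∑ α, N.incidence α (Sum.inr k) * F.1 α) s t :=
      HasDerivWithinAt.fun_sum fun α _ => (hi α).const_mul _
    exact (h1.sub h2).div_const _
  have hY := (((HasDerivWithinAt.fun_sum (u := Finset.univ) fun α _ =>
      ((hU α).pow 2).div_const (2 * N.res α)).add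
    (HasDerivWithinAt.fun_sum (u := Finset.univ) fun k _ =>
      ((hv k).log (hpos k).ne').const_mul (p k))).add
    (HasDerivWithinAt.fun_sum (u := Finset.univ) fun k _ =>
      ((hF2 k).pow 2).const_mul (l * N.cap k / 2))).add
    (HasDerivWithinAt.fun_sum (u := Finset.univ) fun α _ =>
      ((hF1 α).pow 2).const_mul ((l - N.timeConst α) * N.ind α / 2))
  refine hY.congr_deriv ?_
  have e1 := N.sum_mul_drop_extendZero (x t).1 F.2
  have e2 := N.sum_mul_drop_extendZero F.1 F.2
  have s1 : ∑ α, ((2 : ℕ) : ℝ) * N.drop (N.busVoltage (x t).2) α ^ (2 - 1) *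
        N.drop (extendZero F.2) α / (2 * N.res α) +
      ∑ α, (l - N.timeConst α) * N.ind α / 2 * (((2 : ℕ) : ℝ) *
        (N.vectorField p (x t)).1 α ^ (2 - 1) *
        ((-(N.res α * F.1 α) + N.drop (extendZero F.2) α) / N.ind α)) =
      ∑ α, (x t).1 α * N.drop (extendZero F.2) α + l * ∑ α, F.1 α * N.drop (extendZero F.2) α
        - ∑ α, (l - N.timeConst α) * N.res α * F.1 α ^ 2 := by
    rw [Finset.mul_sum, ← Finset.sum_add_distrib, ← Finset.sum_add_distrib,
      ← Finset.sum_sub_distrib]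
    refine Finset.sum_congr rfl fun α _ => ?_
    have hd := N.ind_mul_vectorField_fst p (x t) α
    rw [← hF] at hd ⊢
    have hd' : N.drop (N.busVoltage (x t).2) α = N.ind α * F.1 α + N.res α * (x t).1 α := by
      linarith
    have := (N.res_pos α).ne'
    have := (N.ind_pos α).ne'
    rw [hd', timeConst]
    field_simp
    push_cast
    ring
  have s2 : ∑ k, p k * (F.2 k / (x t).2 k) +
      ∑ k, l * N.cap k / 2 * (((2 : ℕ) : ℝ) * (N.vectorField p (x t)).2 k ^ (2 - 1) *
        ((p k * F.2 k / (x t).2 k ^ 2 - ∑ α, N.incidence α (Sum.inr k) * F.1 α) / N.cap k)) =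
      -∑ k, (N.cap k - l * p k / (x t).2 k ^ 2) * F.2 k ^ 2
        - ∑ k, F.2 k * ∑ α, N.incidence α (Sum.inr k) * (x t).1 α
        - l * ∑ k, F.2 k * ∑ α, N.incidence α (Sum.inr k) * F.1 α := by
    rw [Finset.mul_sum, ← Finset.sum_neg_distrib, ← Finset.sum_add_distrib,
      ← Finset.sum_sub_distrib, ← Finset.sum_sub_distrib]
    refine Finset.sum_congr rfl fun k _ => ?_
    have hd := N.cap_mul_vectorField_snd p (x t) k
    rw [← hF] at hd ⊢
    have hd' : ∑ α, N.incidence α (Sum.inr k) * (x t).1 α =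
      -(p k / (x t).2 k) - N.cap k * F.2 k := by linarith
    have := (hpos k).ne'
    have := (N.cap_pos k).ne'
    rw [hd']
    field_simp
    push_cast
    ring
  rw [storageRate, ← hF]
  rw [← hF, e1, e2] at s1
  rw [← hF] at s2
  linarith

end DCNetwork

namespace DCNetwork

variable {S K E : Type*}

/-! ### The two-bus voltage -/

/-- `Vhigh` is the larger root of `v (V₀ - v) = R p`, and the quadratic decreases beyond `V₀ / 2`.
The converse `le_Vhigh` needs no restriction to that branch. -/
theorem Vhigh_le {V₀ R p v : ℝ} (hV₀ : 0 < V₀) (hv : V₀ / 2 ≤ v)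
    (h : v * (V₀ - v) ≤ R * p) : Vhigh V₀ R p ≤ v := by
  have h1 : √(1 - p / (V₀ ^ 2 / (4 * R))) ≤ 2 * v / V₀ - 1 := by
    rw [Real.sqrt_le_iff]
    constructor
    · rw [sub_nonneg, le_div_iff₀ hV₀]; linarith
    · rw [div_div_eq_mul_div, sub_le_iff_le_add, div_sub_one hV₀.ne', div_pow, ← add_div,
        le_div_iff₀ (by positivity)]
      nlinarith
  calc Vhigh V₀ R p ≤ V₀ / 2 * (1 + (2 * v / V₀ - 1)) := by unfold Vhigh; gcongr
    _ = v := by field_simp; ring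

theorem le_Vhigh {V₀ R p v : ℝ} (hV₀ : 0 < V₀)
    (h : R * p ≤ v * (V₀ - v)) : v ≤ Vhigh V₀ R p := by
  have h1 : 2 * v / V₀ - 1 ≤ √(1 - p / (V₀ ^ 2 / (4 * R))) := by
    refine Real.le_sqrt_of_sq_le ?_
    rw [div_div_eq_mul_div, le_sub_iff_add_le, div_sub_one hV₀.ne', div_pow, ← add_div,
      div_le_one (by positivity)]
    nlinarith
  calc v = V₀ / 2 * (1 + (2 * v / V₀ - 1)) := by field_simp; ring
    _ ≤ Vhigh V₀ R p := by unfold Vhigh; gcongr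

theorem half_le_Vhigh {V₀ R p : ℝ} (hV₀ : 0 < V₀) : V₀ / 2 ≤ Vhigh V₀ R p := by
  unfold Vhigh
  have := Real.sqrt_nonneg (1 - p / (V₀ ^ 2 / (4 * R)))
  nlinarith

theorem Vhigh_pos {V₀ R p : ℝ} (hV₀ : 0 < V₀) : 0 < Vhigh V₀ R p :=
  (half_pos hV₀).trans_le (half_le_Vhigh hV₀)

theorem continuous_Vhigh (V₀ R : ℝ) : Continuous (Vhigh V₀ R) := by
  unfold Vhigh
  fun_prop

theorem continuousOn_switchCapacitance {V₀ Rmax Vtr tauMax : ℝ} {A : Set (ℝ × ℝ)} (hV₀ : 0 < V₀)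
    (hG : ∀ q ∈ A, Gini V₀ Rmax q.1 q.2 < Gtr V₀ Rmax Vtr q.2) :
    ContinuousOn (switchCapacitance V₀ Rmax Vtr tauMax) A := by
  have hV : Continuous fun q : ℝ × ℝ => Vhigh V₀ Rmax q.1 :=
    (continuous_Vhigh V₀ Rmax).comp continuous_fst
  have hV' : ∀ q : ℝ × ℝ, Vhigh V₀ Rmax q.1 ≠ 0 := fun q => (Vhigh_pos hV₀).ne'
  have hGtr : Continuous fun q : ℝ × ℝ => Gtr V₀ Rmax Vtr q.2 := by
    unfold Gtr; fun_prop
  have hGini : Continuous fun q : ℝ × ℝ => Gini V₀ Rmax q.1 q.2 := by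
    unfold Gini
    exact ((continuous_fst.div_const 2).mul ((continuous_const.sub hV).div hV hV')).add
      (continuous_snd.mul continuous_const)
  unfold switchCapacitance
  refine ContinuousOn.mul (continuousOn_const.div
    (continuous_const.mul (hGtr.sub hGini)).continuousOn fun q hq => ?_)
    (((continuous_fst.sub continuous_snd).div hV hV').pow 2).continuousOn
  have := hG q hq
  exact mul_ne_zero two_ne_zero (sub_pos.2 this).ne'

theorem isCompact_admissibleLoads (Pmax pmax : ℝ) : IsCompact (admissibleLoads Pmax pmax) := by
  refine (isCompact_Icc (a := ((0 : ℝ), (0 : ℝ))) (b := (Pmax, Pmax))).of_isClosed_subset ?_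
    fun q hq => ⟨⟨hq.1, hq.2.2.1⟩, ⟨hq.2.1, hq.2.2.2.1⟩⟩
  unfold admissibleLoads
  refine (isClosed_le continuous_const continuous_fst).inter
    ((isClosed_le continuous_fst continuous_const).inter
    ((isClosed_le continuous_const continuous_snd).inter
    ((isClosed_le continuous_snd continuous_const).inter
    (isClosed_le (f := fun q : ℝ × ℝ => |q.2 - q.1|) (by fun_prop) continuous_const))))

/-- A real `sSup` dominates its set only if the set is bounded above; here this follows from
continuity on a compact set, where `Gini < Gtr` keeps the denominator nonzero. -/
theorem switchCapacitance_le_capacitanceBound {V₀ Rmax Vtr tauMax Pmax pmax : ℝ} (hV₀ : 0 < V₀)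
    (hG : ∀ q ∈ admissibleLoads Pmax pmax, Gini V₀ Rmax q.1 q.2 < Gtr V₀ Rmax Vtr q.2)
    {q : ℝ × ℝ} (hq : q ∈ admissibleLoads Pmax pmax) :
    switchCapacitance V₀ Rmax Vtr tauMax q ≤ capacitanceBound V₀ Rmax Vtr tauMax Pmax pmax :=
  le_csSup ((isCompact_admissibleLoads Pmax pmax).image_of_continuousOn
    (continuousOn_switchCapacitance hV₀ hG)).bddAbove (Set.mem_image_of_mem _ hq)

/-! ### Equilibria -/

variable [Fintype S] [Fintype K] [Fintype E]

theorem IsEquilibrium.current_eq {N : DCNetwork S K E} {p : K → ℝ} {x : (E → ℝ) × (K → ℝ)}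
    (hx : N.IsEquilibrium p x) (α : E) : x.1 α = N.drop (N.busVoltage x.2) α / N.res α := by
  have h := N.ind_mul_vectorField_fst p x α
  rw [hx.2] at h
  rw [eq_div_iff (N.res_pos α).ne']
  simp only [Prod.fst_zero, Pi.zero_apply, mul_zero] at h
  linarith

/-- The power flow equations, tested against a function `d` on the loads. -/
theorem IsEquilibrium.sum_drop_mul_drop {N : DCNetwork S K E} {p : K → ℝ}
    {x : (E → ℝ) × (K → ℝ)} (hx : N.IsEquilibrium p x) (d : K → ℝ) :
    ∑ α, N.drop (N.busVoltage x.2) α / N.res α * N.drop (extendZero d) α =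
      -∑ k, p k * (d k / x.2 k) := by
  rw [N.sum_mul_drop_extendZero, ← Finset.sum_neg_distrib]
  refine Finset.sum_congr rfl fun k _ => ?_
  have h := N.cap_mul_vectorField_snd p x k
  rw [hx.2] at h
  simp only [Prod.snd_zero, Pi.zero_apply, mul_zero, hx.current_eq] at h
  rw [show ∑ α, N.incidence α (Sum.inr k) * (N.drop (N.busVoltage x.2) α / N.res α) =
    -(p k / x.2 k) by linarith]
  ring

/-- The power balance at an equilibrium. -/
theorem IsEquilibrium.sum_drop_sq {N : DCNetwork S K E} {p : K → ℝ}
    {x : (E → ℝ) × (K → ℝ)} (hx : N.IsEquilibrium p x) :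
    ∑ α, N.drop (N.busVoltage x.2) α ^ 2 / N.res α =
      ∑ k, p k * ((N.V₀ - x.2 k) / x.2 k) := by
  have h := hx.sum_drop_mul_drop fun k => x.2 k - N.V₀
  simp_rw [← drop_busVoltage] at h
  calc _ = ∑ α, N.drop (N.busVoltage x.2) α / N.res α * N.drop (N.busVoltage x.2) α :=
        Finset.sum_congr rfl fun α _ => by ring
    _ = _ := by
      rw [h, ← Finset.sum_neg_distrib]
      exact Finset.sum_congr rfl fun α _ => by ring

/-- Maximum principle: test the power flow equations with the positive part of `v - V₀`. Truncation
gives `(a⁺ - b⁺)² ≤ (a - b) (a⁺ - b⁺)` on each line, while loads only consume, so the positive part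
has zero energy and vanishes by connectedness. -/
theorem IsEquilibrium.voltage_le {N : DCNetwork S K E} [Nonempty S] (hconn : N.graph.Connected)
    {p : K → ℝ} (hp : ∀ k, 0 ≤ p k) {x : (E → ℝ) × (K → ℝ)} (hx : N.IsEquilibrium p x) (k : K) :
    x.2 k ≤ N.V₀ := by
  set w : K → ℝ := fun k => max (x.2 k - N.V₀) 0 with hw
  have hle : ∑ α, N.drop (extendZero w) α ^ 2 / N.res α ≤ 0 := by
    calc ∑ α, N.drop (extendZero w) α ^ 2 / N.res α
        ≤ ∑ α, N.drop (N.busVoltage x.2) α / N.res α * N.drop (extendZero w) α := by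
          refine Finset.sum_le_sum fun α _ => ?_
          rw [div_mul_eq_mul_div]
          refine div_le_div_of_nonneg_right ?_ (N.res_pos α).le
          have key : ∀ a b : ℝ, (max a 0 - max b 0) ^ 2 ≤ (a - b) * (max a 0 - max b 0) := by
            intro a b
            rcases le_total a 0 with ha | ha <;> rcases le_total b 0 with hb | hb <;>
              simp [ha, hb] <;> nlinarith
          have hmax : ∀ j, extendZero w j =
              max (extendZero (S := S) (fun k => x.2 k - N.V₀) j) 0 := by
            rintro (s | k) <;> simp [extendZero, hw]
          rw [drop_busVoltage]
          simp only [drop, hmax]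
          exact key _ _
      _ = -∑ k, p k * (w k / x.2 k) := hx.sum_drop_mul_drop w
      _ ≤ 0 := by
          rw [neg_nonpos]
          exact Finset.sum_nonneg fun k _ =>
            mul_nonneg (hp k) (div_nonneg (le_max_right _ _) (hx.1 k).le)
  have h := N.sq_extendZero_le hconn le_rfl w k
  have h0 : 0 ≤ ∑ α, N.res α := Finset.sum_nonneg fun α _ => (N.res_pos α).le
  have h1 : w k ^ 2 ≤ 0 := h.trans (mul_nonpos_of_nonneg_of_nonpos h0 hle)
  have h2 : w k = 0 := by nlinarith [sq_nonneg (w k)]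
  have h3 : x.2 k - N.V₀ ≤ w k := le_max_left _ _
  linarith

/-- Equilibria with voltages above `V₀ / 2` are high-voltage equilibria. -/
theorem IsEquilibrium.Vhigh_le {N : DCNetwork S K E} [Nonempty S] (hconn : N.graph.Connected)
    {Rmax : ℝ} (hR : 0 < Rmax) (hRmax : ∑ α, N.res α ≤ Rmax) {p : K → ℝ} (hp : ∀ k, 0 ≤ p k)
    {x : (E → ℝ) × (K → ℝ)} (hx : N.IsEquilibrium p x) (hhalf : ∀ k, N.V₀ / 2 ≤ x.2 k) (k : K) :
    Vhigh N.V₀ Rmax (∑ j, p j) ≤ x.2 k := by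
  have : Nonempty K := ⟨k⟩
  -- At the load `m` of lowest voltage, the power balance gives `(V₀ - v_m)² ≤ Rmax p_Σ (V₀ - v_m) /
  -- v_m`. Cancelling `V₀ - v_m` leaves the quadratic inequality; the case `v_m = V₀` is separate.
  obtain ⟨m, hm⟩ := Finite.exists_min x.2
  refine le_trans ?_ (hm k)
  refine DCNetwork.Vhigh_le N.V₀_pos (hhalf m) ?_
  have hm0 := hx.1 m
  have hpsum : 0 ≤ ∑ j, p j := Finset.sum_nonneg fun j _ => hp j
  have hmV := hx.voltage_le hconn hp m
  rcases hmV.eq_or_lt with heq | hlt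
  · rw [heq, sub_self, mul_zero]; positivity
  have h := N.sq_voltage_sub_le hconn hRmax x.2 m
  rw [hx.sum_drop_sq] at h
  have h2 : ∑ j, p j * ((N.V₀ - x.2 j) / x.2 j) ≤ (∑ j, p j) * ((N.V₀ - x.2 m) / x.2 m) := by
    rw [Finset.sum_mul]
    refine Finset.sum_le_sum fun j _ => mul_le_mul_of_nonneg_left ?_ (hp j)
    exact div_le_div₀ (sub_nonneg.2 hmV) (by linarith [hm j]) hm0 (hm j)
  have h3 : (N.V₀ - x.2 m) * (x.2 m * (N.V₀ - x.2 m)) ≤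
      (N.V₀ - x.2 m) * (Rmax * ∑ j, p j) := by
    have h4 := mul_le_mul_of_nonneg_left (h.trans (mul_le_mul_of_nonneg_left h2 hR.le)) hm0.le
    have h5 : x.2 m * (Rmax * ((∑ j, p j) * ((N.V₀ - x.2 m) / x.2 m))) =
        (N.V₀ - x.2 m) * (Rmax * ∑ j, p j) := by field_simp
    rw [h5] at h4
    linarith
  exact le_of_mul_le_mul_left h3 (sub_pos.2 hlt)

/-- There is at most one equilibrium with voltages above `V₀ / 2`. -/
theorem IsEquilibrium.eq_of_half_le {N : DCNetwork S K E} [Nonempty S]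
    (hconn : N.graph.Connected) {Rmax : ℝ} (hR : 0 < Rmax) (hRmax : ∑ α, N.res α ≤ Rmax)
    {p : K → ℝ} (hp : ∀ k, 0 ≤ p k) (hpsum : ∑ k, p k < N.V₀ ^ 2 / (4 * Rmax))
    {x y : (E → ℝ) × (K → ℝ)} (hx : N.IsEquilibrium p x) (hxhalf : ∀ k, N.V₀ / 2 ≤ x.2 k)
    (hy : N.IsEquilibrium p y) (hyhalf : ∀ k, N.V₀ / 2 ≤ y.2 k) : x = y := by
  have hv : x.2 = y.2 := by
    rcases isEmpty_or_nonempty K with hK | hK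
    · exact Subsingleton.elim _ _
    set d : K → ℝ := fun k => x.2 k - y.2 k with hd
    -- Subtracting the two power flow equations tested with `d` gives its energy. At the load `m`
    -- with largest `d_m²` this yields `d_m² ≤ (4 Rmax p_Σ / V₀²) d_m²`, with a factor below one.
    have hsum : ∑ α, N.drop (extendZero d) α ^ 2 / N.res α =
        ∑ k, p k * (d k ^ 2 / (x.2 k * y.2 k)) := by
      have h1 := hx.sum_drop_mul_drop d
      have h2 := hy.sum_drop_mul_drop d
      have h3 : ∑ α, N.drop (extendZero d) α ^ 2 / N.res α =
          ∑ α, N.drop (N.busVoltage x.2) α / N.res α * N.drop (extendZero d) α -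
          ∑ α, N.drop (N.busVoltage y.2) α / N.res α * N.drop (extendZero d) α := by
        rw [← Finset.sum_sub_distrib]
        refine Finset.sum_congr rfl fun α _ => ?_
        have := N.drop_busVoltage_sub x.2 y.2 α
        rw [← hd] at this
        rw [← sub_mul, ← sub_div, this]
        ring
      rw [h3, h1, h2, neg_sub_neg, ← Finset.sum_sub_distrib]
      refine Finset.sum_congr rfl fun k _ => ?_
      have := (hx.1 k).ne'
      have := (hy.1 k).ne'
      simp only [hd]
      field_simp
    obtain ⟨m, hm⟩ := Finite.exists_max fun k => d k ^ 2
    have hV := N.V₀_pos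
    have hle : ∑ k, p k * (d k ^ 2 / (x.2 k * y.2 k)) ≤
        (∑ k, p k) * (d m ^ 2 / (N.V₀ ^ 2 / 4)) := by
      rw [Finset.sum_mul]
      refine Finset.sum_le_sum fun k _ => mul_le_mul_of_nonneg_left ?_ (hp k)
      refine div_le_div₀ (sq_nonneg _) (hm k) (by positivity) ?_
      have := mul_le_mul (hxhalf k) (hyhalf k) (by positivity) (hx.1 k).le
      linarith
    have h := N.sq_extendZero_le hconn hRmax d m
    rw [hsum] at h
    have h' := h.trans (mul_le_mul_of_nonneg_left hle hR.le)
    have hdm : d m ^ 2 = 0 := by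
      by_contra hne
      have hpos : 0 < d m ^ 2 := lt_of_le_of_ne (sq_nonneg _) (Ne.symm hne)
      rw [lt_div_iff₀ (by positivity)] at hpsum
      have h4 : Rmax * ((∑ k, p k) * (d m ^ 2 / (N.V₀ ^ 2 / 4))) =
          (∑ k, p k) * (4 * Rmax) * d m ^ 2 / N.V₀ ^ 2 := by field_simp
      rw [h4, le_div_iff₀ (by positivity)] at h'
      have := mul_lt_mul_of_pos_right hpsum hpos
      linarith
    funext k
    have h5 : d k ^ 2 ≤ d m ^ 2 := hm k
    have h6 : d k = 0 := by nlinarith [sq_nonneg (d k)]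
    exact sub_eq_zero.1 h6
  refine Prod.ext ?_ hv
  funext α
  rw [hx.current_eq, hy.current_eq, hv]

/-! ### Bounds on the Lyapunov function -/

theorem storage_sub_ge {N : DCNetwork S K E} {p : K → ℝ} (hp : ∀ k, 0 ≤ p k) {l Vtr : ℝ}
    (hVtr : 0 < Vtr) {x : (E → ℝ) × (K → ℝ)} (hx : ∀ k, Vtr ≤ x.2 k) (hl0 : 0 ≤ l) :
    ∑ α, N.drop (N.busVoltage x.2) α ^ 2 / (2 * N.res α) + (∑ k, p k) * Real.log Vtr +
      ∑ α, (l - N.timeConst α) * N.ind α / 2 * (N.vectorField p x).1 α ^ 2 ≤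
    N.storage p l x := by
  have h1 : (∑ k, p k) * Real.log Vtr ≤ ∑ k, p k * Real.log (x.2 k) := by
    rw [Finset.sum_mul]
    exact Finset.sum_le_sum fun k _ =>
      mul_le_mul_of_nonneg_left (Real.log_le_log hVtr (hx k)) (hp k)
  have h2 : 0 ≤ ∑ k, l * N.cap k / 2 * (N.vectorField p x).2 k ^ 2 :=
    Finset.sum_nonneg fun k _ => by have := N.cap_pos k; positivity
  unfold storage
  linarith

/-- At `x.2 k = Vtr` the left side is exactly `Gtr`: this is the barrier. It also bounds the
voltages on sublevel sets. -/
theorem sq_voltage_add_le_storage {N : DCNetwork S K E} [Nonempty S] (hconn : N.graph.Connected)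
    {Rmax : ℝ} (hR : 0 < Rmax) (hRmax : ∑ α, N.res α ≤ Rmax) {p : K → ℝ} (hp : ∀ k, 0 ≤ p k)
    {l Vtr : ℝ} (hVtr : 0 < Vtr) (hl0 : 0 ≤ l) (hl : ∀ α, N.timeConst α ≤ l)
    {x : (E → ℝ) × (K → ℝ)} (hx : ∀ k, Vtr ≤ x.2 k) (k : K) :
    (x.2 k - N.V₀) ^ 2 / (2 * Rmax) + (∑ k, p k) * Real.log Vtr ≤ N.storage p l x := by
  have h := storage_sub_ge (N := N) hp hVtr hx hl0
  have h1 : 0 ≤ ∑ α, (l - N.timeConst α) * N.ind α / 2 * (N.vectorField p x).1 α ^ 2 :=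
    Finset.sum_nonneg fun α _ => by
      have := N.ind_pos α; have := sub_nonneg.2 (hl α); positivity
  have h2 : (x.2 k - N.V₀) ^ 2 / (2 * Rmax) ≤
      ∑ α, N.drop (N.busVoltage x.2) α ^ 2 / (2 * N.res α) := by
    rw [sum_drop_sq_half, div_le_div_iff₀ (by positivity) two_pos]
    nlinarith [N.sq_voltage_sub_le hconn hRmax x.2 k]
  linarith

/-- When `τ_α < l` this bounds `di_α/dt` on sublevel sets, and then the line equation bounds the
current. -/
theorem sq_vectorField_add_le_storage {N : DCNetwork S K E} {p : K → ℝ} (hp : ∀ k, 0 ≤ p k)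
    {l Vtr : ℝ} (hVtr : 0 < Vtr) (hl0 : 0 ≤ l) (hl : ∀ α, N.timeConst α ≤ l)
    {x : (E → ℝ) × (K → ℝ)} (hx : ∀ k, Vtr ≤ x.2 k) (α : E) :
    (l - N.timeConst α) * N.ind α / 2 * (N.vectorField p x).1 α ^ 2 +
      (∑ k, p k) * Real.log Vtr ≤ N.storage p l x := by
  have h := storage_sub_ge (N := N) hp hVtr hx hl0
  have h1 := Finset.single_le_sum
    (f := fun α => (l - N.timeConst α) * N.ind α / 2 * (N.vectorField p x).1 α ^ 2)
    (fun α _ => by have := N.ind_pos α; have := sub_nonneg.2 (hl α); positivity)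
    (Finset.mem_univ α)
  have h2 := N.sum_drop_sq_nonneg (N.busVoltage x.2)
  rw [sum_drop_sq_half] at h
  linarith

/-- The value of the Lyapunov function right after the switching of a single load. -/
theorem storage_le_of_switch {N : DCNetwork S K E} [Nonempty S] (hconn : N.graph.Connected)
    {Rmax : ℝ} {p q : K → ℝ} (hp : ∀ k, 0 ≤ p k) (hq : ∀ k, 0 ≤ q k) {κ : K}
    (hswitch : ∀ k, k ≠ κ → q k = p k) {l : ℝ} (hl0 : 0 ≤ l)
    {x : (E → ℝ) × (K → ℝ)} (hx : N.IsHighVoltageEquilibrium Rmax p x) :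
    N.storage q l x ≤ Gini N.V₀ Rmax (∑ k, p k) (∑ k, q k) +
      l / (2 * N.cap κ) * ((∑ k, p k - ∑ k, q k) / Vhigh N.V₀ Rmax (∑ k, p k)) ^ 2 := by
  set V := Vhigh N.V₀ Rmax (∑ k, p k) with hV
  have hVpos : 0 < V := Vhigh_pos N.V₀_pos
  have hle : ∀ k, x.2 k ≤ N.V₀ := hx.1.voltage_le hconn hp
  have h1 : ∑ α, N.drop (N.busVoltage x.2) α ^ 2 / (2 * N.res α) ≤
      (∑ k, p k) / 2 * ((N.V₀ - V) / V) := by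
    rw [sum_drop_sq_half, hx.1.sum_drop_sq, div_mul_eq_mul_div]
    refine div_le_div_of_nonneg_right ?_ two_pos.le
    rw [Finset.sum_mul]
    refine Finset.sum_le_sum fun k _ => mul_le_mul_of_nonneg_left ?_ (hp k)
    refine div_le_div₀ ?_ ?_ hVpos (hx.2 k)
    · linarith [hle k, hx.2 k]
    · linarith [hx.2 k]
  have h2 : ∑ k, q k * Real.log (x.2 k) ≤ (∑ k, q k) * Real.log N.V₀ := by
    rw [Finset.sum_mul]
    exact Finset.sum_le_sum fun k _ =>
      mul_le_mul_of_nonneg_left (Real.log_le_log (hx.1.1 k) (hle k)) (hq k)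
  -- The line equations do not involve the powers, so the currents are still at rest after the
  -- switch; by `hF2` only the load `κ` acquires a velocity.
  have hF1 : ∀ α, (N.vectorField q x).1 α = 0 := fun α => congrFun (congrArg Prod.fst hx.1.2) α
  have hF2 : ∀ k, (N.vectorField q x).2 k = (p k - q k) / x.2 k / N.cap k := by
    intro k
    have h := N.cap_mul_vectorField_snd p x k
    have h' := N.cap_mul_vectorField_snd q x k
    rw [hx.1.2] at h
    simp only [Prod.snd_zero, Pi.zero_apply, mul_zero] at h
    rw [eq_div_iff (N.cap_pos k).ne', sub_div]
    linarith
  have hdiff : ∑ k, p k - ∑ k, q k = p κ - q κ := by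
    rw [← Finset.sum_sub_distrib]
    exact Fintype.sum_eq_single κ fun k hk => by rw [hswitch k hk, sub_self]
  have h3 : ∑ k, l * N.cap k / 2 * (N.vectorField q x).2 k ^ 2 ≤
      l / (2 * N.cap κ) * ((p κ - q κ) / V) ^ 2 := by
    rw [Fintype.sum_eq_single κ fun k hk => by rw [hF2, hswitch k hk]; simp, hF2]
    have hc := N.cap_pos κ
    have h4 : l * N.cap κ / 2 * ((p κ - q κ) / x.2 κ / N.cap κ) ^ 2 =
        l / (2 * N.cap κ) * ((p κ - q κ) / x.2 κ) ^ 2 := by field_simp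
    rw [h4, div_pow, div_pow]
    have := hx.2 κ
    gcongr
  have h5 : ∑ α, (l - N.timeConst α) * N.ind α / 2 * (N.vectorField q x).1 α ^ 2 = 0 :=
    Finset.sum_eq_zero fun α _ => by rw [hF1]; simp
  rw [hdiff]
  unfold storage Gini
  rw [← hV]
  linarith

end DCNetwork

end

noncomputable section

/-! ### Coordinate boxes -/

section Box

variable {K E : Type*}

/-- The states with currents in `[-b, b]` and voltages in `[a, b]`. -/
def stateBox (K E : Type*) (a b : ℝ) : Set ((E → ℝ) × (K → ℝ)) :=
  Set.Icc (fun _ => -b, fun _ => a) (fun _ => b, fun _ => b)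

theorem mem_stateBox {a b : ℝ} {x : (E → ℝ) × (K → ℝ)} :
    x ∈ stateBox K E a b ↔ (∀ α, -b ≤ x.1 α ∧ x.1 α ≤ b) ∧ ∀ k, a ≤ x.2 k ∧ x.2 k ≤ b := by
  simp only [stateBox, Set.mem_Icc, Prod.le_def, Pi.le_def, forall_and]
  tauto

/-- The coordinatewise truncation to `stateBox`. -/
def stateClamp (a b : ℝ) (x : (E → ℝ) × (K → ℝ)) : (E → ℝ) × (K → ℝ) :=
  (fun α => max (-b) (min b (x.1 α)), fun k => max a (min b (x.2 k)))

theorem stateClamp_mem {a b : ℝ} (ha : 0 ≤ a) (hab : a ≤ b) (x : (E → ℝ) × (K → ℝ)) :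
    stateClamp a b x ∈ stateBox K E a b :=
  mem_stateBox.2 ⟨fun _ => ⟨le_max_left _ _, max_le (by linarith) (min_le_left _ _)⟩,
    fun _ => ⟨le_max_left _ _, max_le hab (min_le_left _ _)⟩⟩

theorem stateClamp_of_mem {a b : ℝ} {x : (E → ℝ) × (K → ℝ)} (hx : x ∈ stateBox K E a b) :
    stateClamp a b x = x := by
  rw [mem_stateBox] at hx
  refine Prod.ext (funext fun α => ?_) (funext fun k => ?_)
  · simp [stateClamp, hx.1 α]
  · simp [stateClamp, hx.2 k]

theorem isCompact_stateBox (a b : ℝ) : IsCompact (stateBox K E a b) := isCompact_Icc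

theorem convex_stateBox (a b : ℝ) : Convex ℝ (stateBox K E a b) := convex_Icc _ _

variable [Fintype K] [Fintype E]

theorem lipschitzWith_stateClamp (a b : ℝ) :
    LipschitzWith 1 (stateClamp a b : (E → ℝ) × (K → ℝ) → (E → ℝ) × (K → ℝ)) := by
  have key : ∀ c u w : ℝ, dist (max c (min b u)) (max c (min b w)) ≤ dist u w := fun c u w => by
    rw [Real.dist_eq, Real.dist_eq]
    calc |max c (min b u) - max c (min b w)| ≤ max |c - c| |min b u - min b w| :=
          abs_max_sub_max_le_max _ _ _ _
      _ ≤ |u - w| := by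
          rw [sub_self, abs_zero]
          refine max_le (abs_nonneg _) ((abs_min_sub_min_le_max _ _ _ _).trans ?_)
          simp
  refine LipschitzWith.of_dist_le_mul fun x y => ?_
  rw [NNReal.coe_one, one_mul, Prod.dist_eq]
  refine max_le ((dist_pi_le_iff dist_nonneg).2 fun α => (key _ _ _).trans ?_)
    ((dist_pi_le_iff dist_nonneg).2 fun k => (key _ _ _).trans ?_)
  · exact (dist_le_pi_dist x.1 y.1 α).trans (le_max_left _ _)
  · exact (dist_le_pi_dist x.2 y.2 k).trans (le_max_right _ _)

theorem stateBox_mem_nhds {a b : ℝ} {x : (E → ℝ) × (K → ℝ)}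
    (h1 : ∀ α, -b < x.1 α ∧ x.1 α < b) (h2 : ∀ k, a < x.2 k ∧ x.2 k < b) :
    stateBox K E a b ∈ 𝓝 x := by
  have e1 : ∀ᶠ y in 𝓝 x, ∀ α, -b < y.1 α ∧ y.1 α < b := eventually_all.2 fun α => by
    have hc : ContinuousAt (fun y : (E → ℝ) × (K → ℝ) => y.1 α) x := by fun_prop
    exact hc (Ioo_mem_nhds (h1 α).1 (h1 α).2)
  have e2 : ∀ᶠ y in 𝓝 x, ∀ k, a < y.2 k ∧ y.2 k < b := eventually_all.2 fun k => by
    have hc : ContinuousAt (fun y : (E → ℝ) × (K → ℝ) => y.2 k) x := by fun_prop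
    exact hc (Ioo_mem_nhds (h2 k).1 (h2 k).2)
  filter_upwards [e1, e2] with y hy1 hy2
  exact mem_stateBox.2 ⟨fun α => ⟨(hy1 α).1.le, (hy1 α).2.le⟩,
    fun k => ⟨(hy2 k).1.le, (hy2 k).2.le⟩⟩

end Box

/-! ### The network dynamics on a box: choice of `l`, regularity, trapping and convergence. -/

namespace DCNetwork

/-- A time constant that dominates all lines and meets the conditions on the capacitances. -/
theorem exists_timeConst {S K E : Type*} [Finite K] {N : DCNetwork S K E} [Nonempty E] {pmax : K → ℝ}
    (hpmax : ∀ k, 0 ≤ pmax k) {Vtr tau tauMax : ℝ}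
    (htau : ∀ α, N.timeConst α ≤ tau) (htauMax : ∀ α, N.timeConst α < tauMax)
    (hC : ∀ k, tau * pmax k / Vtr ^ 2 < N.cap k) :
    ∃ l, 0 < l ∧ l ≤ tauMax ∧ (∀ α, N.timeConst α < l) ∧
      ∀ k, l * pmax k / Vtr ^ 2 < N.cap k := by
  -- `tau` may equal some `τ_α`, so it is increased slightly, which the strict capacitance condition
  -- allows; the minimum with `tauMax` then serves the second capacitance condition.
  have hev : ∀ᶠ u in 𝓝[>] tau, ∀ k, u * pmax k / Vtr ^ 2 < N.cap k := by
    refine eventually_all.2 fun k => ?_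
    have hc : ContinuousAt (fun u : ℝ => u * pmax k / Vtr ^ 2) tau := by fun_prop
    exact (hc.eventually_lt continuousAt_const (hC k)).filter_mono nhdsWithin_le_nhds
  obtain ⟨u, hu, hut⟩ := (hev.and self_mem_nhdsWithin).exists
  have hut' : tau < u := hut
  have hlt : ∀ α, N.timeConst α < min u tauMax := fun α =>
    lt_min ((htau α).trans_lt hut') (htauMax α)
  refine ⟨min u tauMax, ?_, min_le_right _ _, hlt, fun k => ?_⟩
  · obtain ⟨α⟩ := ‹Nonempty E›
    exact (div_pos (N.ind_pos α) (N.res_pos α)).trans (hlt α)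
  · refine lt_of_le_of_lt ?_ (hu k)
    have := hpmax k
    gcongr
    exact min_le_left _ _

variable {S K E : Type*} [Fintype S] [Fintype K] [Fintype E]

theorem contDiffOn_vectorField (N : DCNetwork S K E) (p : K → ℝ) :
    ContDiffOn ℝ 1 (N.vectorField p) {x | ∀ k, 0 < x.2 k} := by
  refine ContDiffOn.prodMk (contDiffOn_pi.2 fun α => ?_) (contDiffOn_pi.2 fun k => ?_)
  · have hbus : ∀ j, ContDiff ℝ 1 fun x : (E → ℝ) × (K → ℝ) => N.busVoltage x.2 j := by
      rintro (s | k)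
      · exact contDiff_const
      · simp only [busVoltage, Sum.elim_inr]; fun_prop
    refine ContDiff.contDiffOn (ContDiff.div_const (ContDiff.add (by fun_prop) ?_) _)
    exact ContDiff.sum fun j _ => contDiff_const.mul (hbus j)
  · refine ContDiffOn.div_const (ContDiffOn.sub (ContDiffOn.neg (ContDiffOn.div
      contDiffOn_const (by fun_prop) fun x hx => (hx k).ne')) (by fun_prop)) _

theorem continuousOn_storage (N : DCNetwork S K E) (p : K → ℝ) (l : ℝ) :
    ContinuousOn (N.storage p l) {x | ∀ k, 0 < x.2 k} := by
  have hF := (N.contDiffOn_vectorField p).continuousOn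
  have hF1 : ∀ α, ContinuousOn (fun x => (N.vectorField p x).1 α) {x | ∀ k, 0 < x.2 k} :=
    fun α => (continuous_apply α).comp_continuousOn (continuous_fst.comp_continuousOn hF)
  have hF2 : ∀ k, ContinuousOn (fun x => (N.vectorField p x).2 k) {x | ∀ k, 0 < x.2 k} :=
    fun k => (continuous_apply k).comp_continuousOn (continuous_snd.comp_continuousOn hF)
  have hbus : ∀ j, Continuous fun x : (E → ℝ) × (K → ℝ) => N.busVoltage x.2 j := by
    rintro (s | k)
    · exact continuous_const
    · simp only [busVoltage, Sum.elim_inr]; fun_prop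
  unfold storage
  refine (((continuousOn_finsetSum _ fun α _ => ?_).add
    (continuousOn_finsetSum _ fun k _ => ?_)).add
    (continuousOn_finsetSum _ fun k _ => continuousOn_const.mul ((hF2 k).pow 2))).add
    (continuousOn_finsetSum _ fun α _ => continuousOn_const.mul ((hF1 α).pow 2))
  · exact ((((hbus _).sub (hbus _)).pow 2).div_const _).continuousOn
  · exact continuousOn_const.mul (ContinuousOn.log (by fun_prop) fun x hx => (hx k).ne')

theorem continuousOn_storageRate (N : DCNetwork S K E) (p : K → ℝ) (l : ℝ) :
    ContinuousOn (N.storageRate p l) {x | ∀ k, 0 < x.2 k} := by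
  have hF := (N.contDiffOn_vectorField p).continuousOn
  have hF1 : ∀ α, ContinuousOn (fun x => (N.vectorField p x).1 α) {x | ∀ k, 0 < x.2 k} :=
    fun α => (continuous_apply α).comp_continuousOn (continuous_fst.comp_continuousOn hF)
  have hF2 : ∀ k, ContinuousOn (fun x => (N.vectorField p x).2 k) {x | ∀ k, 0 < x.2 k} :=
    fun k => (continuous_apply k).comp_continuousOn (continuous_snd.comp_continuousOn hF)
  unfold storageRate
  refine (continuousOn_finsetSum _ fun k _ => ContinuousOn.mul ?_ ((hF2 k).pow 2)).add
    (continuousOn_finsetSum _ fun α _ => continuousOn_const.mul ((hF1 α).pow 2))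
  exact continuousOn_const.sub (continuousOn_const.div (by fun_prop)
    fun x hx => (pow_pos (hx k) 2).ne')

/-- Above the voltage `Vtr`, sublevel sets of the Lyapunov function are bounded. -/
theorem exists_bound_of_storage_le {N : DCNetwork S K E} [Nonempty S]
    (hconn : N.graph.Connected) {Rmax : ℝ} (hR : 0 < Rmax) (hRmax : ∑ α, N.res α ≤ Rmax)
    {p : K → ℝ} (hp : ∀ k, 0 ≤ p k) {l Vtr : ℝ} (hVtr : 0 < Vtr) (hl0 : 0 ≤ l)
    (hl : ∀ α, N.timeConst α < l) (c : ℝ) :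
    ∃ b, Vtr ≤ b ∧ ∀ x : (E → ℝ) × (K → ℝ), (∀ k, Vtr ≤ x.2 k) → N.storage p l x ≤ c →
      (∀ α, |x.1 α| < b) ∧ ∀ k, x.2 k < b := by
  have habs : ∀ {u m : ℝ}, u ^ 2 ≤ m → |u| ≤ m + 1 := fun {u m} h => by
    nlinarith [sq_abs u, sq_nonneg (|u| - 1), abs_nonneg u]
  set M := c - (∑ k, p k) * Real.log Vtr with hM
  set Q := M * (2 * Rmax) + 1 with hQ
  -- `A α` bounds the current through `R i = U - L di/dt`, where `|U| ≤ 2 |Q|` and `|di/dt|` is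
  -- controlled by the last sum in `storage`.
  set A : E → ℝ := fun α =>
    (2 * |Q| + N.ind α * (|M / ((l - N.timeConst α) * N.ind α / 2)| + 1)) / N.res α with hA
  have hA0 : ∀ α, 0 ≤ A α := fun α => by
    have := N.ind_pos α; have := N.res_pos α; positivity
  have hA1 : 0 ≤ ∑ α, A α := Finset.sum_nonneg fun α _ => hA0 α
  refine ⟨Vtr + N.V₀ + |Q| + ∑ α, A α + 1, by linarith [N.V₀_pos, abs_nonneg Q],
    fun x hx hc => ?_⟩
  have hv : ∀ k, |x.2 k - N.V₀| ≤ |Q| := fun k => by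
    have h := sq_voltage_add_le_storage (N := N) hconn hR hRmax hp hVtr hl0
      (fun α => (hl α).le) hx k
    have h' : (x.2 k - N.V₀) ^ 2 ≤ M * (2 * Rmax) := by
      rw [← div_le_iff₀ (by positivity)]; linarith
    exact (habs h').trans (le_abs_self _)
  have hbus : ∀ j, |N.busVoltage x.2 j - N.V₀| ≤ |Q| := by
    rintro (s | k)
    · simp [busVoltage]
    · simpa [busVoltage] using hv k
  have hi : ∀ α, |x.1 α| ≤ A α := fun α => by
    have hL := N.ind_pos α
    have hRα := N.res_pos α
    have hlα := sub_pos.2 (hl α)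
    have h := sq_vectorField_add_le_storage (N := N) hp hVtr hl0 (fun α => (hl α).le) hx α
    have h' : (N.vectorField p x).1 α ^ 2 ≤ M / ((l - N.timeConst α) * N.ind α / 2) := by
      rw [le_div_iff₀ (by positivity)]; linarith
    have h1 : |(N.vectorField p x).1 α| ≤
        |M / ((l - N.timeConst α) * N.ind α / 2)| + 1 :=
      (habs h').trans (by gcongr; exact le_abs_self _)
    have h2 : |N.drop (N.busVoltage x.2) α| ≤ 2 * |Q| := by
      have e1 := abs_le.1 (hbus (N.src α))
      have e2 := abs_le.1 (hbus (N.tgt α))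
      rw [abs_le]
      unfold drop
      constructor <;> linarith
    have h3 : N.res α * x.1 α =
        N.drop (N.busVoltage x.2) α - N.ind α * (N.vectorField p x).1 α := by
      have := N.ind_mul_vectorField_fst p x α
      linarith
    rw [hA, le_div_iff₀ hRα]
    calc |x.1 α| * N.res α = |N.res α * x.1 α| := by rw [abs_mul, abs_of_pos hRα, mul_comm]
      _ ≤ |N.drop (N.busVoltage x.2) α| + |N.ind α * (N.vectorField p x).1 α| := by
          rw [h3]; exact abs_sub _ _
      _ ≤ _ := by
          rw [abs_mul, abs_of_pos hL]
          gcongr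
  have hV := N.V₀_pos
  have hQ0 := abs_nonneg Q
  constructor
  · intro α
    have h1 := hi α
    have h2 := Finset.single_le_sum (f := A) (fun α _ => hA0 α) (Finset.mem_univ α)
    linarith
  · intro k
    have := (abs_le.1 (hv k)).2
    linarith

/-- The function `storage` is a strict Lyapunov function for the dynamics on a box. -/
theorem exists_isStrictLyapunov {N : DCNetwork S K E} [Nonempty S]
    (hconn : N.graph.Connected) {Rmax : ℝ} (hR : 0 < Rmax) (hRmax : ∑ α, N.res α ≤ Rmax)
    {p : K → ℝ} (hp : ∀ k, 0 ≤ p k) (hpsum : ∑ k, p k < N.V₀ ^ 2 / (4 * Rmax))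
    {l Vtr c : ℝ} (hVtr : N.V₀ / 2 ≤ Vtr) (hl0 : 0 ≤ l)
    (hl : ∀ α, N.timeConst α < l) (hcap : ∀ k, l * p k / Vtr ^ 2 < N.cap k)
    (hc : c < Gtr N.V₀ Rmax Vtr (∑ k, p k)) :
    ∃ b, Vtr ≤ b ∧
      IsStrictLyapunov (N.vectorField p) (N.storage p l) (N.storageRate p l)
        (stateBox K E Vtr b) c ∧
      ∀ x : (E → ℝ) × (K → ℝ), (∀ k, Vtr ≤ x.2 k) → N.storage p l x ≤ c →
        x ∈ stateBox K E Vtr b := by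
  have hVpos : 0 < Vtr := (half_pos N.V₀_pos).trans_le hVtr
  obtain ⟨b, hb, hbound⟩ := exists_bound_of_storage_le (N := N) hconn hR hRmax hp hVpos hl0 hl c
  have hsub : stateBox K E Vtr b ⊆ {x | ∀ k, 0 < x.2 k} := fun x hx k =>
    hVpos.trans_le ((mem_stateBox.1 hx).2 k).1
  have hcoef : ∀ x ∈ stateBox K E Vtr b, ∀ k, 0 < N.cap k - l * p k / x.2 k ^ 2 := by
    intro x hx k
    have h1 := ((mem_stateBox.1 hx).2 k).1
    have h2 : l * p k / x.2 k ^ 2 ≤ l * p k / Vtr ^ 2 := by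
      have := hp k
      gcongr
    linarith [hcap k]
  have hcoef' : ∀ α, 0 < (l - N.timeConst α) * N.res α := fun α =>
    mul_pos (sub_pos.2 (hl α)) (N.res_pos α)
  have hsum1 : ∀ x ∈ stateBox K E Vtr b, ∀ k ∈ Finset.univ,
      0 ≤ (N.cap k - l * p k / x.2 k ^ 2) * (N.vectorField p x).2 k ^ 2 := fun x hx k _ =>
    mul_nonneg (hcoef x hx k).le (sq_nonneg _)
  have hsum2 : ∀ x, ∀ α ∈ Finset.univ,
      0 ≤ (l - N.timeConst α) * N.res α * (N.vectorField p x).1 α ^ 2 := fun x α _ =>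
    mul_nonneg (hcoef' α).le (sq_nonneg _)
  refine ⟨b, hb, ?_, fun x hx hxc => ?_⟩
  · refine
    { compact := isCompact_stateBox _ _
      continuousOn := (N.continuousOn_storage p l).mono hsub
      continuousOn_rate := (N.continuousOn_storageRate p l).mono hsub
      hasDeriv := fun x s t hx h => N.hasDerivWithinAt_storage p l x s t (hsub hx) h
      rate_nonneg := fun x hx =>
        add_nonneg (Finset.sum_nonneg (hsum1 x hx)) (Finset.sum_nonneg (hsum2 x))
      eq_zero_of_rate := fun x hx h0 => ?_
      mem_nhds := fun x hx hxc => ?_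
      unique := fun x hx _ hx0 y hy _ hy0 => ?_ }
    · unfold storageRate at h0
      obtain ⟨h1, h2⟩ := (add_eq_zero_iff_of_nonneg (Finset.sum_nonneg (hsum1 x hx))
        (Finset.sum_nonneg (hsum2 x))).1 h0
      rw [Finset.sum_eq_zero_iff_of_nonneg (hsum1 x hx)] at h1
      rw [Finset.sum_eq_zero_iff_of_nonneg (hsum2 x)] at h2
      refine Prod.ext (funext fun α => ?_) (funext fun k => ?_)
      · simpa [(hcoef' α).ne'] using
          (mul_eq_zero.1 (h2 α (Finset.mem_univ α))).resolve_left (hcoef' α).ne'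
      · simpa using
          (mul_eq_zero.1 (h1 k (Finset.mem_univ k))).resolve_left (hcoef x hx k).ne'
    · have hxv : ∀ k, Vtr ≤ x.2 k := fun k => ((mem_stateBox.1 hx).2 k).1
      obtain ⟨h1, h2⟩ := hbound x hxv hxc
      refine stateBox_mem_nhds (fun α => abs_lt.1 (h1 α)) fun k =>
        ⟨lt_of_le_of_ne (hxv k) fun heq => ?_, h2 k⟩
      -- On the face `v_k = Vtr` the barrier would give `Gtr ≤ storage ≤ c`, against `c < Gtr`.
      have h := sq_voltage_add_le_storage (N := N) hconn hR hRmax hp hVpos hl0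
        (fun α => (hl α).le) hxv k
      rw [← heq] at h
      unfold Gtr at hc
      linarith
    · exact IsEquilibrium.eq_of_half_le hconn hR hRmax hp hpsum ⟨hsub hx, hx0⟩
        (fun k => hVtr.trans ((mem_stateBox.1 hx).2 k).1) ⟨hsub hy, hy0⟩
        (fun k => hVtr.trans ((mem_stateBox.1 hy).2 k).1)
  · obtain ⟨h1, h2⟩ := hbound x hx hxc
    exact mem_stateBox.2 ⟨fun α => ⟨(abs_lt.1 (h1 α)).1.le, (abs_lt.1 (h1 α)).2.le⟩,
      fun k => ⟨hx k, (h2 k).le⟩⟩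

/-- If the Lyapunov function is below `Gtr` at a state `x₀` with voltages above `Vtr`, then the
high-voltage equilibrium exists, is unique and asymptotically stable, and attracts `x₀`. -/
theorem exists_stable_of_storage_lt {N : DCNetwork S K E} [Nonempty S]
    (hconn : N.graph.Connected) {Rmax : ℝ} (hR : 0 < Rmax) (hRmax : ∑ α, N.res α ≤ Rmax)
    {p : K → ℝ} (hp : ∀ k, 0 ≤ p k) (hpsum : ∑ k, p k < N.V₀ ^ 2 / (4 * Rmax))
    {l Vtr : ℝ} (hVtr : N.V₀ / 2 ≤ Vtr) (hl0 : 0 ≤ l)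
    (hl : ∀ α, N.timeConst α < l) (hcap : ∀ k, l * p k / Vtr ^ 2 < N.cap k)
    {x₀ : (E → ℝ) × (K → ℝ)} (hx₀ : ∀ k, Vtr ≤ x₀.2 k)
    (hlt : N.storage p l x₀ < Gtr N.V₀ Rmax Vtr (∑ k, p k)) :
    ∃ z : (E → ℝ) × (K → ℝ),
      N.IsHighVoltageEquilibrium Rmax p z ∧
      (∀ y, N.IsHighVoltageEquilibrium Rmax p y → y = z) ∧
      N.IsAsymptoticallyStable p z ∧
      (∃ x, N.IsTrajectory p x ∧ x 0 = x₀) ∧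
      ∀ x, N.IsTrajectory p x → x 0 = x₀ → Tendsto x atTop (𝓝 z) := by
  have hVpos : 0 < Vtr := (half_pos N.V₀_pos).trans_le hVtr
  -- The level lies strictly below `Gtr` for the barrier and strictly above the value at `x₀`, so
  -- the minimizer is strictly below it, as stability requires.
  obtain ⟨c, hc0, hc1⟩ := exists_between hlt
  obtain ⟨b, hb, hY, hbox⟩ := exists_isStrictLyapunov (N := N) hconn hR hRmax hp hpsum hVtr
    hl0 hl hcap hc1
  have hsub : stateBox K E Vtr b ⊆ {x | ∀ k, 0 < x.2 k} := fun x hx k =>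
    hVpos.trans_le ((mem_stateBox.1 hx).2 k).1
  obtain ⟨kF, hkF⟩ := ((N.contDiffOn_vectorField p).mono hsub).exists_lipschitzOnWith one_ne_zero
    (convex_stateBox Vtr b) (isCompact_stateBox Vtr b)
  have hx₀B : x₀ ∈ stateBox K E Vtr b := hbox x₀ hx₀ hc0.le
  obtain ⟨z, hzB, hzc, hz0, hmin⟩ := hY.exists_minimizer ⟨x₀, hx₀B, hc0.le⟩
  have hzlt : N.storage p l z < c := (hmin x₀ hx₀B hc0.le).trans_lt hc0
  have hzeq : N.IsEquilibrium p z := ⟨hsub hzB, hz0⟩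
  have hzhalf : ∀ k, N.V₀ / 2 ≤ z.2 k := fun k => hVtr.trans ((mem_stateBox.1 hzB).2 k).1
  have hexist : ∀ y ∈ stateBox K E Vtr b, N.storage p l y ≤ c →
      ∃ x, N.IsTrajectory p x ∧ x 0 = y := fun y hy hyc => by
    obtain ⟨x, hx0, hxB, hx⟩ := hY.exists_solution hkF (lipschitzWith_stateClamp Vtr b)
      (stateClamp_mem hVpos.le hb) (fun x hx => stateClamp_of_mem hx) hy hyc
    exact ⟨x, ⟨fun t ht => hsub (hxB t ht), hx⟩, hx0⟩
  refine ⟨z, ⟨hzeq, hzeq.Vhigh_le hconn hR hRmax hp hzhalf⟩, fun y hy => ?_, ⟨fun ε hε => ?_, ?_⟩,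
    hexist x₀ hx₀B hc0.le, fun x hx hx0 => ?_⟩
  · exact IsEquilibrium.eq_of_half_le hconn hR hRmax hp hpsum hy.1
      (fun k => (half_le_Vhigh N.V₀_pos).trans (hy.2 k)) hzeq hzhalf
  · obtain ⟨δ, hδ, h⟩ := hY.exists_forall_dist_lt hzB hzlt hmin hε
    refine ⟨δ, hδ, fun y hy => ?_⟩
    obtain ⟨hyB, hyc, hstay⟩ := h y hy
    exact ⟨hexist y hyB hyc, fun x hx hx0 => hstay x hx0 hx.hasDeriv⟩
  · obtain ⟨δ, hδ, h⟩ := hY.exists_forall_dist_lt hzB hzlt hmin one_pos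
    refine ⟨δ, hδ, fun x hx hx0 => ?_⟩
    obtain ⟨hyB, hyc, -⟩ := h (x 0) hx0
    exact hY.tendsto hzB hzc hmin hx.hasDeriv hyB hyc
  · exact hY.tendsto hzB hzc hmin hx.hasDeriv (hx0 ▸ hx₀B) (hx0 ▸ hc0.le)

end DCNetwork

end

/-! ### The switching theorem. -/

theorem mainTheorem1 {S K E : Type*} [Fintype S] [Fintype K] [Fintype E]
    (N : DCNetwork S K E)
    -- connected network with at least one source
    (hsource : Nonempty S) (hconn : N.graph.Connected)
    -- design parameters
    (Rmax Pmax Vmin Vtr tau tauMax : ℝ) (pmax : K → ℝ)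
    (hRmax : ∑ α, N.res α ≤ Rmax)
    (hPmax : Pmax < N.V₀ ^ 2 / (4 * Rmax))
    (hVmin : N.V₀ / 2 < Vmin) (hVmin' : Vmin < N.V₀)
    (hPVmin : Pmax ≤ Vmin * (N.V₀ - Vmin) / Rmax)
    (hVtr : N.V₀ / 2 ≤ Vtr) (hVtr' : Vtr ≤ Vmin)
    (htau : ∀ α, N.timeConst α ≤ tau) (htauMax : ∀ α, N.timeConst α < tauMax)
    -- the two conditions on the capacitances; the second one includes that its bound exists
    (hC_tr : ∀ k, tau * pmax k / Vtr ^ 2 < N.cap k)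
    (hG : ∀ k, ∀ q ∈ DCNetwork.admissibleLoads Pmax (pmax k),
      DCNetwork.Gini N.V₀ Rmax q.1 q.2 < DCNetwork.Gtr N.V₀ Rmax Vtr q.2)
    (hC_bound : ∀ k,
      DCNetwork.capacitanceBound N.V₀ Rmax Vtr tauMax Pmax (pmax k) < N.cap k)
    -- the loads before and after the switching of the load `κ`
    (pMinus pPlus : K → ℝ) (κ : K)
    (hMinus : ∀ k, 0 ≤ pMinus k ∧ pMinus k ≤ pmax k)
    (hPlus : ∀ k, 0 ≤ pPlus k ∧ pPlus k ≤ pmax k)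
    (hMinusSum : ∑ k, pMinus k ≤ Pmax) (hPlusSum : ∑ k, pPlus k ≤ Pmax)
    (hswitch : ∀ k, k ≠ κ → pPlus k = pMinus k)
    -- the pre-switch state
    (xMinus : (E → ℝ) × (K → ℝ))
    (hxMinus : N.IsHighVoltageEquilibrium Rmax pMinus xMinus) :
    ∃ xsep : (E → ℝ) × (K → ℝ),
      N.IsHighVoltageEquilibrium Rmax pPlus xsep ∧
      (∀ y, N.IsHighVoltageEquilibrium Rmax pPlus y → y = xsep) ∧
      N.IsAsymptoticallyStable pPlus xsep ∧
      (∃ x, N.IsTrajectory pPlus x ∧ x 0 = xMinus) ∧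
      ∀ x, N.IsTrajectory pPlus x → x 0 = xMinus → Tendsto x atTop (𝓝 xsep) := by
  have : Nonempty K := ⟨κ⟩
  have : Nonempty E := N.nonempty_lines hconn
  have hV₀ := N.V₀_pos
  have hR : 0 < Rmax :=
    (Finset.sum_pos (fun α _ => N.res_pos α) Finset.univ_nonempty).trans_le hRmax
  have hVpos : 0 < Vtr := (half_pos hV₀).trans_le hVtr
  have hp : ∀ k, 0 ≤ pMinus k := fun k => (hMinus k).1
  have hq : ∀ k, 0 ≤ pPlus k := fun k => (hPlus k).1
  obtain ⟨l, hl0, hlmax, hl, hcap⟩ := DCNetwork.exists_timeConst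
    (fun k => (hq k).trans (hPlus k).2) htau htauMax hC_tr
  have hadm : (∑ k, pMinus k, ∑ k, pPlus k) ∈ DCNetwork.admissibleLoads Pmax (pmax κ) := by
    refine ⟨Finset.sum_nonneg fun k _ => hp k, hMinusSum, Finset.sum_nonneg fun k _ => hq k,
      hPlusSum, ?_⟩
    have hdiff : ∑ k, pPlus k - ∑ k, pMinus k = pPlus κ - pMinus κ := by
      rw [← Finset.sum_sub_distrib]
      exact Fintype.sum_eq_single κ fun k hk => by rw [hswitch k hk, sub_self]
    rw [hdiff, abs_le]
    constructor <;> linarith [(hPlus κ).1, (hPlus κ).2, (hMinus κ).1, (hMinus κ).2]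
  have hgap := sub_pos.2 (hG κ _ hadm)
  have hC := (DCNetwork.switchCapacitance_le_capacitanceBound (tauMax := tauMax) hV₀ (hG κ)
    hadm).trans_lt (hC_bound κ)
  refine DCNetwork.exists_stable_of_storage_lt hconn hR hRmax hq (hPlusSum.trans_lt hPmax) hVtr
    hl0.le hl (fun k => lt_of_le_of_lt ?_ (hcap k)) (fun k => ?_)
    ((DCNetwork.storage_le_of_switch hconn hp hq hswitch hl0.le hxMinus).trans_lt ?_)
  · have := (hPlus k).2
    gcongr
  -- The bound on `Pmax` says that `Vmin` lies below `Vhigh` for every permitted total load, so the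
  -- initial voltages are at least `Vmin ≥ Vtr`.
  · refine hVtr'.trans ((DCNetwork.le_Vhigh hV₀ ?_).trans (hxMinus.2 k))
    rw [le_div_iff₀ hR] at hPVmin
    nlinarith
  -- The capacitance condition at the actual pair of total loads, solved for the gap `Gtr - Gini`;
  -- `l ≤ tauMax` transfers it to the chosen time constant.
  · have hcκ := N.cap_pos κ
    unfold DCNetwork.switchCapacitance at hC
    rw [← lt_sub_iff_add_lt', div_mul_eq_mul_div, div_lt_iff₀ (by positivity)]
    rw [div_mul_eq_mul_div, div_lt_iff₀ (by positivity)] at hC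
    have hle := mul_le_mul_of_nonneg_right hlmax (sq_nonneg
      ((∑ k, pMinus k - ∑ k, pPlus k) / DCNetwork.Vhigh N.V₀ Rmax (∑ k, pMinus k)))
    linarith
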